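/- Let $d\in\{2,3\}$, let $\Omega\subset\mathbb R^d$ be the interior of a bounded convex polygon/polyhedron and let $\mathcal T_h$ be a finite mesh of $\overline\Omega$ by convex polytopes $K$ with disjoint interiors and without hanging nodes (different edges/faces of elements overlap only in sets of zero $(d-1)$-dimensional measure). Write $\boldsymbol n$ for the outward unit normal on $\partial K$, $(\cdot,\cdot)_K$ and $\langle\cdot,\cdot\rangle_{\partial K}$ for the $L^2$ inner products, $(\cdot,\cdot)_{\mathcal T_h}=\sum_K(\cdot,\cdot)_K$, $\langle\cdot,\cdot\rangle_{\partial\mathcal T_h}=\sum_K\langle\cdot,\cdot\rangle_{\partial K}$, $\|\cdot\|$ for the norm of $L^2(\Omega)$ and $\|\mu\|_{\partial\mathcal T_h}^2=\langle\mu,\mu\rangle_{\partial\mathcal T_h}$. Let $\tau>0$ be constant on each facet of each element (possibly different on the two sides of a facet). **Spaces.** Let $\boldsymbol V(K)\subset\{\boldsymbol v\in H(\mathrm{div};K):\boldsymbol v\cdot\boldsymbol n\in L^2(\partial K)\}$, $W(K)\subset H^1(K)$ and, for each edge/face $e$, $M(e)\subset L^2(e)$ and $\boldsymbol N(e)\subset\{\boldsymbol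 r\in L^2(e)^d:(I-\boldsymbol n\otimes\boldsymbol n)\boldsymbol r=\boldsymbol 0\}$ be finite-dimensional subspaces with $\nabla W(K)\subset\boldsymbol V(K)$, $\nabla\cdot\boldsymbol V(K)\subset W(K)$ and, for all $K$ and all facets $e$ of $K$: (A1) $\mu\boldsymbol n\in\boldsymbol N(e)$ for $\mu\in M(e)$; (A2) $\boldsymbol r\cdot\boldsymbol n\in M(e)$ for $\boldsymbol r\in\boldsymbol N(e)$; (A3) $\boldsymbol v|_e\cdot\boldsymbol n\in M(e)$ for $\boldsymbol v\in\boldsymbol V(K)$; (A4) $w|_e\in M(e)$ for $w\in W(K)$. Put $M(\partial K)=\prod_{e\subset\partial K}M(e)$, $\boldsymbol N(\partial K)=\prod_{e\subset\partial K}\boldsymbol N(e)$. Let $\boldsymbol V_h$, $W_h$ be the spaces of functions on $\Omega$ that are elementwise in $\boldsymbol V(K)$, $W(K)$, let $M_h$ be the space of single-valued $\mu$ with $\mu|_e\in M(e)$ for all $e$ and $\mu=0$ on $\partial\Omega$, and $\boldsymbol N_h$ the space of single-valued $\boldsymbol r$ with $\boldsymbol r|_e\in\boldsymbol N(e)$ for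 all $e$. Let $P_M$ be the facewise $L^2$-projection onto $M(e)$. **$M$-decomposition.** Assume that for every $K$ the space $\boldsymbol V(K)\times W(K)$ admits an $M$-decomposition: the map $\mathrm{tr}(\boldsymbol v,w)=(\boldsymbol v\cdot\boldsymbol n+w)|_{\partial K}$ sends $\boldsymbol V(K)\times W(K)$ into $M(\partial K)$, and there are subspaces $\widetilde{\boldsymbol V}\subset\boldsymbol V(K)$, $\widetilde W\subset W(K)$ with $\nabla W(K)\subset\widetilde{\boldsymbol V}$, $\nabla\cdot\boldsymbol V(K)\subset\widetilde W$ such that $\mathrm{tr}:\widetilde{\boldsymbol V}^\perp\times\widetilde W^\perp\to M(\partial K)$ is an isomorphism, where $\perp$ denotes $L^2(K)$-orthogonal complements in $\boldsymbol V(K)$ and $W(K)$. **Exact solution.** Let $f\in L^2(\Omega)$ and let $(\boldsymbol q,u)$ solve $\boldsymbol q+\nabla u=0$, $\nabla\cdot\boldsymbol q=f$ in $\Omega$, $u=0$ on $\partial\Omega$, with $u\in H^1(\Omega)$, $\boldsymbol q\in H(\mathrm{div};\Omega)$, and normal traces $\boldsymbol q\cdot\boldsymbol n\in L^2(\partial\Omega)$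 and $\boldsymbol q\cdot\boldsymbol n\in L^2(\partial K)$ for all $K$ (as is the case when $u\in H^2(\Omega)$). **HDG-projection.** An HDG-projection of $(\boldsymbol q,u)$ is given, on every $K$, by a pair $(\boldsymbol\Pi_V\boldsymbol q,\Pi_Wu)\in\boldsymbol V(K)\times W(K)$ with $$(\Pi_Wu,\nabla\cdot\boldsymbol v)_K=(u,\nabla\cdot\boldsymbol v)_K\quad\forall\boldsymbol v\in\boldsymbol V(K),\qquad(\boldsymbol\Pi_V\boldsymbol q,\nabla w)_K=(\boldsymbol q,\nabla w)_K\quad\forall w\in W(K),$$ $$\langle\boldsymbol\Pi_V\boldsymbol q\cdot\boldsymbol n+\tau\Pi_Wu,\mu\rangle_{\partial K}=\langle\boldsymbol q\cdot\boldsymbol n+\tau P_Mu,\mu\rangle_{\partial K}\quad\forall\mu\in M(\partial K).$$ **HDG method.** Let $\boldsymbol q_h\in\boldsymbol V_h$, $u_h\in W_h$ and the double-valued hybrid variables $\widehat{\boldsymbol q}_h\in\prod_K\boldsymbol N(\partial K)$, $\widehat u_h\in\prod_KM(\partial K)$ satisfy $$(\boldsymbol q_h,\boldsymbol v)_{\mathcal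 T_h}-(u_h,\nabla\cdot\boldsymbol v)_{\mathcal T_h}+\langle\widehat u_h,\boldsymbol v\cdot\boldsymbol n\rangle_{\partial\mathcal T_h}=0\quad\forall\boldsymbol v\in\boldsymbol V_h,$$ $$-(\boldsymbol q_h,\nabla w)_{\mathcal T_h}+\langle\widehat{\boldsymbol q}_h\cdot\boldsymbol n,w\rangle_{\partial\mathcal T_h}=(f,w)\quad\forall w\in W_h,$$ $$\langle\widehat{\boldsymbol q}_h\cdot\boldsymbol n,\mu\rangle_{\partial\mathcal T_h}=0\quad\forall\mu\in M_h,\qquad\langle\widehat u_h,\boldsymbol r\cdot\boldsymbol n\rangle_{\partial\mathcal T_h}=0\quad\forall\boldsymbol r\in\boldsymbol N_h,$$ $$(\boldsymbol q_h-\widehat{\boldsymbol q}_h)\cdot\boldsymbol n+\tau(u_h-\widehat u_h)=0\quad\text{on }\partial K\ \ \forall K\in\mathcal T_h,$$ and assume that on every edge/face $\widehat u_h$ or $\widehat{\boldsymbol q}_h$ is single-valued. **Theorem.** An HDG-projection of $(\boldsymbol q,u)$ exists. For every HDG-projection and every such solution of the HDG method, the projected errors $\boldsymbol e_{\boldsymbol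 q}=\boldsymbol\Pi_V\boldsymbol q-\boldsymbol q_h$, $e_u=\Pi_Wu-u_h$, $e_{\widehat u}=P_Mu-\widehat u_h$ satisfy $$\|\boldsymbol e_{\boldsymbol q}\|^2+2\|\tau^{1/2}(e_u-e_{\widehat u})\|_{\partial\mathcal T_h}^2\le\|\boldsymbol q-\boldsymbol\Pi_V\boldsymbol q\|^2.$$ -/

import Mathlib

open MeasureTheory Set
open scoped ContDiff RealInnerProductSpace

namespace HDG

noncomputable section

/-- The Euclidean space `ℝ^d`. -/
abbrev Eu (d : ℕ) := EuclideanSpace ℝ (Fin d)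

/-- A `d`-dimensional convex polytope (polygon or polyhedron): a bounded finite intersection of
closed half-spaces with nonempty interior.  `facets` is its set of edges (`d = 2`) or faces
(`d = 3`), each of them a set of dimension `d - 1` in one of the bounding hyperplanes, and
`normal e` is the outward unit normal vector on the facet `e`. -/
structure Polytope (d : ℕ) where
  carrier : Set (Eu d)
  facets : Finset (Set (Eu d))
  normal : Set (Eu d) → Eu d
  offset : Set (Eu d) → ℝ
  norm_normal : ∀ e ∈ facets, ‖normal e‖ = 1
  carrier_eq : carrier = {x | ∀ e ∈ facets, ⟪normal e, x⟫ ≤ offset e}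
  facet_eq : ∀ e ∈ facets, e = {x ∈ carrier | ⟪normal e, x⟫ = offset e}
  facet_dim : ∀ e ∈ facets, Module.finrank ℝ (vectorSpan ℝ e) + 1 = d
  bounded : Bornology.IsBounded carrier
  nonempty_interior : (interior carrier).Nonempty

/-- The open polytope. -/
def Polytope.dom {d : ℕ} (K : Polytope d) : Set (Eu d) := interior K.carrier

/-- `L²(K)` for the open polytope. -/
abbrev L2 {d : ℕ} (K : Polytope d) := Lp ℝ 2 ((volume : Measure (Eu d)).restrict K.dom)

/-- `L²(K)^d`. -/
abbrev L2Vec {d : ℕ} (K : Polytope d) := Lp (Eu d) 2 ((volume : Measure (Eu d)).restrict K.dom)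

/-- `L²(e)` with respect to the `(d-1)`-dimensional surface measure (the Hausdorff measure,
normalized so that it is Lebesgue measure on hyperplanes). -/
abbrev L2Face {d : ℕ} (e : Set (Eu d)) := Lp ℝ 2 ((μHE[d - 1] : Measure (Eu d)).restrict e)

/-- `L²(e)^d`. -/
abbrev L2FaceVec {d : ℕ} (e : Set (Eu d)) :=
  Lp (Eu d) 2 ((μHE[d - 1] : Measure (Eu d)).restrict e)

/-- `L²(∂K)`, given facet by facet. -/
abbrev L2Bdry {d : ℕ} (K : Polytope d) := ∀ e : K.facets, L2Face (e : Set (Eu d))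

/-- The triples `(ψ|_K, ∇ψ|_K, ψ|_{∂K})` of smooth functions `ψ` on `ℝ^d`. -/
def smoothTriples {d : ℕ} (K : Polytope d) : Submodule ℝ (L2 K × L2Vec K × L2Bdry K) where
  carrier := {x | ∃ ψ : Eu d → ℝ, ContDiff ℝ ∞ ψ ∧
    x.1 =ᵐ[volume.restrict K.dom] ψ ∧
    x.2.1 =ᵐ[volume.restrict K.dom] gradient ψ ∧
    ∀ e : K.facets, x.2.2 e =ᵐ[(μHE[d - 1] : Measure (Eu d)).restrict (e : Set (Eu d))] ψ}
  zero_mem' := by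
    refine ⟨fun _ => 0, contDiff_const, Lp.coeFn_zero _ _ _, ?_, fun e => Lp.coeFn_zero _ _ _⟩
    filter_upwards [Lp.coeFn_zero (Eu d) 2 ((volume : Measure (Eu d)).restrict K.dom)] with a ha
    simpa [gradient] using ha
  add_mem' := by
    rintro x y ⟨ψ, hψ, h1, h2, h3⟩ ⟨χ, hχ, k1, k2, k3⟩
    refine ⟨ψ + χ, hψ.add hχ, (Lp.coeFn_add _ _).trans (h1.add k1), ?_,
      fun e => (Lp.coeFn_add _ _).trans ((h3 e).add (k3 e))⟩
    filter_upwards [Lp.coeFn_add x.2.1 y.2.1, h2, k2] with a ha hb hc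
    have e1 : DifferentiableAt ℝ ψ a := (hψ.differentiable (by simp)).differentiableAt
    have e2 : DifferentiableAt ℝ χ a := (hχ.differentiable (by simp)).differentiableAt
    have : gradient (ψ + χ) a = gradient ψ a + gradient χ a := by
      simp only [gradient, fderiv_add e1 e2, map_add]
    rw [this, ← hb, ← hc]
    exact ha
  smul_mem' := by
    rintro c x ⟨ψ, hψ, h1, h2, h3⟩
    refine ⟨c • ψ, contDiff_const.smul hψ, (Lp.coeFn_smul _ _).trans (h1.const_smul c), ?_,
      fun e => (Lp.coeFn_smul _ _).trans ((h3 e).const_smul c)⟩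
    filter_upwards [Lp.coeFn_smul c x.2.1, h2] with a ha hb
    have e1 : DifferentiableAt ℝ ψ a := (hψ.differentiable (by simp)).differentiableAt
    have : gradient (c • ψ) a = c • gradient ψ a := by
      simp only [gradient, fderiv_const_smul e1 c, map_smulₛₗ]
      simp
    rw [this, ← hb]
    exact ha

/-- The Sobolev space `H¹(K)`, an element `w` being recorded together with its weak gradient and
its trace: the closure of the smooth functions in the `H¹(K)` norm, the trace being the
`L²(∂K)`-limit of the boundary values of the approximating smooth functions. -/
def H1 {d : ℕ} (K : Polytope d) : Submodule ℝ (L2 K × L2Vec K × L2Bdry K) :=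
  (smoothTriples K).topologicalClosure

/-- The function in `L²(K)`. -/
def H1.val {d : ℕ} {K : Polytope d} (w : H1 K) : L2 K := w.1.1

/-- The weak gradient. -/
def H1.grad {d : ℕ} {K : Polytope d} (w : H1 K) : L2Vec K := w.1.2.1

/-- The trace on a facet. -/
def H1.tr {d : ℕ} {K : Polytope d} (w : H1 K) (e : K.facets) : L2Face (e : Set (Eu d)) := w.1.2.2 e

/-- The space of all `v ∈ H(div; K)` with `v · n ∈ L²(∂K)`, where `n` is the outward unit normal.
An element `v` is recorded together with its weak divergence `∇·v` and its normal trace `v · n`,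
which are defined by
`(v, ∇ψ)_K + (∇·v, ψ)_K = ⟨v · n, ψ⟩_{∂K}` for all smooth functions `ψ` on `ℝ^d`. -/
def HDiv {d : ℕ} (K : Polytope d) : Submodule ℝ (L2Vec K × L2 K × L2Bdry K) where
  carrier := {v | ∀ ψ ∈ smoothTriples K,
    (inner ℝ v.1 ψ.2.1 : ℝ) + inner ℝ v.2.1 ψ.1 = ∑ e : K.facets, inner ℝ (v.2.2 e) (ψ.2.2 e)}
  zero_mem' := by
    intro ψ _
    simp
  add_mem' := by
    intro x y hx hy ψ hψ
    have h1 := hx ψ hψ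
    have h2 := hy ψ hψ
    simp only [Prod.fst_add, Prod.snd_add, Pi.add_apply, inner_add_left, Finset.sum_add_distrib]
    linarith
  smul_mem' := by
    intro c x hx ψ hψ
    have h1 := hx ψ hψ
    simp only [Prod.smul_fst, Prod.smul_snd, Pi.smul_apply, real_inner_smul_left,
      ← Finset.mul_sum, ← h1]
    ring

/-- The vector field in `L²(K)^d`. -/
def HDiv.val {d : ℕ} {K : Polytope d} (v : HDiv K) : L2Vec K := v.1.1

/-- The weak divergence. -/
def HDiv.div {d : ℕ} {K : Polytope d} (v : HDiv K) : L2 K := v.1.2.1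

/-- The normal trace `v · n` on a facet, for the outward unit normal `n`. -/
def HDiv.ntr {d : ℕ} {K : Polytope d} (v : HDiv K) (e : K.facets) : L2Face (e : Set (Eu d)) :=
  v.1.2.2 e

/-- `r · n` for a vector field `r` on a face and a constant vector `n`. -/
def dotN {d : ℕ} {e : Set (Eu d)} (n : Eu d) (r : L2FaceVec e) : L2Face e :=
  (innerSL ℝ n).compLp r

/-- `μ n` for a scalar function `μ` on a face and a constant vector `n`. -/
def mulN {d : ℕ} {e : Set (Eu d)} (n : Eu d) (μ : L2Face e) : L2FaceVec e :=
  (ContinuousLinearMap.toSpanSingleton ℝ n).compLp μ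

/-- The polytopes `K t` are the elements of a mesh of the polytope `P`: they cover it, have
disjoint interiors, and two different edges/faces of elements overlap in a null set only
(there are no hanging nodes). -/
structure IsMesh {d : ℕ} {T : Type*} (P : Polytope d) (K : T → Polytope d) : Prop where
  cover : ⋃ t, (K t).carrier = P.carrier
  disjoint : Pairwise fun s t => Disjoint (K s).dom (K t).dom
  conforming : ∀ s t, ∀ e ∈ (K s).facets, ∀ e' ∈ (K t).facets, e ≠ e' →
    (μHE[d - 1] : Measure (Eu d)) (e ∩ e') = 0

/-- The standing assumptions on the finite element spaces `V(K)`, `W(K)`, `M(e)`, `N(e)`. -/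
structure IsFESpaces {d : ℕ} {T : Type*} (K : T → Polytope d)
    (V : ∀ t, Submodule ℝ (HDiv (K t))) (W : ∀ t, Submodule ℝ (H1 (K t)))
    (M : ∀ e : Set (Eu d), Submodule ℝ (L2Face e))
    (N : ∀ e : Set (Eu d), Submodule ℝ (L2FaceVec e)) : Prop where
  grad_mem : ∀ t, ∀ w ∈ W t, ∃ v ∈ V t, HDiv.val v = H1.grad w
  div_mem : ∀ t, ∀ v ∈ V t, ∃ w ∈ W t, H1.val w = HDiv.div v
  /-- `(I - n ⊗ n) r = 0` for `r ∈ N(e)`. -/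
  tangential : ∀ t, ∀ e ∈ (K t).facets, ∀ r ∈ N e,
    mulN ((K t).normal e) (dotN ((K t).normal e) r) = r
  A1 : ∀ t, ∀ e ∈ (K t).facets, ∀ μ ∈ M e, mulN ((K t).normal e) μ ∈ N e
  A2 : ∀ t, ∀ e ∈ (K t).facets, ∀ r ∈ N e, dotN ((K t).normal e) r ∈ M e
  A3 : ∀ t, ∀ v ∈ V t, ∀ e : (K t).facets, HDiv.ntr v e ∈ M e
  A4 : ∀ t, ∀ w ∈ W t, ∀ e : (K t).facets, H1.tr w e ∈ M e

/-- `V(K) × W(K)` admits an `M`-decomposition: `tr (v, w) = v · n + w` maps `V × W` into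
`M(∂K)`, and there are subspaces `V' ⊆ V`, `W' ⊆ W` with `∇W ⊆ V'`, `∇·V ⊆ W'` such that
`tr` is an isomorphism of `V'^⊥ × W'^⊥` onto `M(∂K)`, where the orthogonal complements are those
of `L²(K)`, taken in `V` and in `W`. -/
def AdmitsMDecomposition {d : ℕ} (K : Polytope d)
    (V : Submodule ℝ (HDiv K)) (W : Submodule ℝ (H1 K))
    (M : ∀ e : Set (Eu d), Submodule ℝ (L2Face e)) : Prop :=
  (∀ v ∈ V, ∀ w ∈ W, ∀ e : K.facets, HDiv.ntr v e + H1.tr w e ∈ M e) ∧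
  ∃ (V' : Submodule ℝ (HDiv K)) (W' : Submodule ℝ (H1 K)), V' ≤ V ∧ W' ≤ W ∧
    (∀ w ∈ W, ∃ v ∈ V', HDiv.val v = H1.grad w) ∧
    (∀ v ∈ V, ∃ w ∈ W', H1.val w = HDiv.div v) ∧
    ∀ μ : L2Bdry K, (∀ e : K.facets, μ e ∈ M e) →
      ∃! p : HDiv K × H1 K,
        (p.1 ∈ V ∧ ∀ v ∈ V', inner ℝ (HDiv.val p.1) (HDiv.val v) = (0 : ℝ)) ∧
        (p.2 ∈ W ∧ ∀ w ∈ W', inner ℝ (H1.val p.2) (H1.val w) = (0 : ℝ)) ∧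
        ∀ e : K.facets, HDiv.ntr p.1 e + H1.tr p.2 e = μ e

/-- `(q, u)` solves `q + ∇u = 0` and `∇·q = f` in `Ω`, `u = 0` on `∂Ω`, where `Ω` is the interior
of the polytope `P`. -/
structure IsExactSolution {d : ℕ} (P : Polytope d) (f : L2 P) (q : HDiv P) (u : H1 P) : Prop where
  flux : HDiv.val q + H1.grad u = 0
  balance : HDiv.div q = f
  dirichlet : ∀ e : P.facets, H1.tr u e = 0

/-- `uK` is the restriction to `K` of the function `u` on `P` (for `K ⊆ P`). -/
def IsRestrH1 {d : ℕ} {P K : Polytope d} (u : H1 P) (uK : H1 K) : Prop :=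
  H1.val uK =ᵐ[volume.restrict K.dom] H1.val u ∧
  H1.grad uK =ᵐ[volume.restrict K.dom] H1.grad u

/-- `qK` is the restriction to `K` of the vector field `q` on `P` (for `K ⊆ P`). -/
def IsRestrHDiv {d : ℕ} {P K : Polytope d} (q : HDiv P) (qK : HDiv K) : Prop :=
  HDiv.val qK =ᵐ[volume.restrict K.dom] HDiv.val q ∧
  HDiv.div qK =ᵐ[volume.restrict K.dom] HDiv.div q

/-- `(qh, uh, qhat, uhat)` is a solution of the unified HDG formulation with stabilization
parameter `τ`.  Both hybrid variables are double-valued: `qhat t e` and `uhat t e` are the values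
on the facet `e` of the element `t`.  Functions of `M_h` and `N_h`, which are single-valued, are
families indexed by the faces only. -/
structure IsHDGSolution {d : ℕ} {T : Type*} [Fintype T] (P : Polytope d) (K : T → Polytope d)
    (V : ∀ t, Submodule ℝ (HDiv (K t))) (W : ∀ t, Submodule ℝ (H1 (K t)))
    (M : ∀ e : Set (Eu d), Submodule ℝ (L2Face e))
    (N : ∀ e : Set (Eu d), Submodule ℝ (L2FaceVec e))
    (τ : ∀ t, (K t).facets → ℝ) (f : L2 P)
    (qh : ∀ t, HDiv (K t)) (uh : ∀ t, H1 (K t))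
    (qhat : ∀ t, ∀ e : (K t).facets, L2FaceVec (e : Set (Eu d)))
    (uhat : ∀ t, L2Bdry (K t)) : Prop where
  qh_mem : ∀ t, qh t ∈ V t
  uh_mem : ∀ t, uh t ∈ W t
  qhat_mem : ∀ t, ∀ e : (K t).facets, qhat t e ∈ N e
  uhat_mem : ∀ t, ∀ e : (K t).facets, uhat t e ∈ M e
  /-- On every face, `uhat` is single-valued or `qhat` is single-valued. -/
  single_valued : ∀ e : Set (Eu d),
    (∀ s t, ∀ (hs : e ∈ (K s).facets) (ht : e ∈ (K t).facets), uhat s ⟨e, hs⟩ = uhat t ⟨e, ht⟩) ∨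
    (∀ s t, ∀ (hs : e ∈ (K s).facets) (ht : e ∈ (K t).facets), qhat s ⟨e, hs⟩ = qhat t ⟨e, ht⟩)
  grad_eq : ∀ v : ∀ t, HDiv (K t), (∀ t, v t ∈ V t) →
    ∑ t, (inner ℝ (HDiv.val (qh t)) (HDiv.val (v t)) : ℝ)
      - ∑ t, inner ℝ (H1.val (uh t)) (HDiv.div (v t))
      + ∑ t, ∑ e : (K t).facets, inner ℝ (uhat t e) (HDiv.ntr (v t) e) = 0
  div_eq : ∀ w : ∀ t, H1 (K t), (∀ t, w t ∈ W t) →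
    - ∑ t, (inner ℝ (HDiv.val (qh t)) (H1.grad (w t)) : ℝ)
      + ∑ t, ∑ e : (K t).facets, inner ℝ (dotN ((K t).normal e) (qhat t e)) (H1.tr (w t) e)
      = ∑ t, ∫ x in (K t).dom, f x * H1.val (w t) x
  /-- Transmission condition for `qhat`, tested with `μ ∈ M_h`, so that `μ = 0` on `∂Ω`. -/
  trans_qhat : ∀ μ : ∀ e : Set (Eu d), L2Face e, (∀ e, μ e ∈ M e) →
    (∀ t, ∀ e ∈ (K t).facets, e ⊆ frontier P.dom → μ e = 0) →
    ∑ t, ∑ e : (K t).facets, (inner ℝ (dotN ((K t).normal e) (qhat t e)) (μ (e : Set (Eu d))) : ℝ) = 0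
  /-- Transmission condition for `uhat`, tested with `r ∈ N_h`. -/
  trans_uhat : ∀ r : ∀ e : Set (Eu d), L2FaceVec e, (∀ e, r e ∈ N e) →
    ∑ t, ∑ e : (K t).facets, (inner ℝ (uhat t e) (dotN ((K t).normal e) (r (e : Set (Eu d)))) : ℝ) = 0
  flux : ∀ t, ∀ e : (K t).facets, HDiv.ntr (qh t) e - dotN ((K t).normal e) (qhat t e)
    + τ t e • (H1.tr (uh t) e - uhat t e) = 0

/-- `(PVq, PWu) ∈ V(K) × W(K)` is an HDG-projection of `(q, u)` on the element `K`, where `P_M` is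
the `L²`-projection onto `M(e)` on every facet `e`. -/
structure IsHDGProjection {d : ℕ} (K : Polytope d)
    (V : Submodule ℝ (HDiv K)) (W : Submodule ℝ (H1 K))
    (M : ∀ e : Set (Eu d), Submodule ℝ (L2Face e)) [∀ e, FiniteDimensional ℝ (M e)]
    (τ : K.facets → ℝ) (q : HDiv K) (u : H1 K) (PVq : HDiv K) (PWu : H1 K) : Prop where
  memV : PVq ∈ V
  memW : PWu ∈ W
  eq_div : ∀ v ∈ V,
    (inner ℝ (H1.val PWu) (HDiv.div v) : ℝ) = inner ℝ (H1.val u) (HDiv.div v)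
  eq_grad : ∀ w ∈ W,
    (inner ℝ (HDiv.val PVq) (H1.grad w) : ℝ) = inner ℝ (HDiv.val q) (H1.grad w)
  eq_bdry : ∀ μ : L2Bdry K, (∀ e : K.facets, μ e ∈ M e) →
    ∑ e : K.facets, (inner ℝ (HDiv.ntr PVq e + τ e • H1.tr PWu e) (μ e) : ℝ)
      = ∑ e : K.facets,
          inner ℝ (HDiv.ntr q e + τ e • (M (e : Set (Eu d))).starProjection (H1.tr u e)) (μ e)

end

end HDG

/-! The estimate is an energy argument. Testing the HDG equations with `e_q` and `e_u`, and using
Green's formula on each element for the pairs `(e_q, u)`, `(q, e_u)`, `(e_q, e_u)` together with the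
projection equations, gives (`element_energy`, summed over the mesh) `‖e_q‖² + ‖τ^{1/2}(e_u - e_û)‖²
+ (q - Π_V q, e_q) + ∑ ⟨e_û, P_M(q·n) - q̂·n⟩ = 0`. The algebra on a facet is `facet_energy`:
subtracting the flux relation from the projection relation yields `e_q·n = P_M(q·n) - q̂·n - τ(e_u -
e_û)`.

The skeleton term vanishes facet by facet (`IsHDGSolution.sum_inner_hybrid_eq_zero`). On a shared
facet `e_û` is the same from both sides, while `q·n` and `q̂·n` change sign; on an unshared facet
`e_û = 0`. For the hybrid variables this follows from the transmission conditions, localized to one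
facet. For the exact solution it needs geometry, because `IsRestrH1` and `IsRestrHDiv` say nothing
about traces: these are recovered from Green's formula with test functions supported near the
relative interior of a facet, where a polytope is a half-space (`ntr_add_ntr_eq_zero`, `tr_eq_tr`,
`IsMesh.tr_eq_zero`). Young's inequality then gives the constant one.

The projection exists because its equations fix the components in `V'` and `W'`, and the remainder
in `V'^⊥ × W'^⊥` must have a prescribed trace `v·n + τw`. The `M`-decomposition makes the dimensions
equal, and Green's formula with `τ > 0` gives injectivity (`exists_projection_of_decomposition`). -/

namespace HDG

/-! ### Surface measure on hyperplanes and integration over half-spaces. -/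

section HalfSpace

theorem finrank_orthogonal_span_singleton_eu {d : ℕ} {n : Eu d} (hn : ‖n‖ = 1) :
    Module.finrank ℝ (ℝ ∙ n)ᗮ = d - 1 := by
  have hn0 : n ≠ 0 := by rintro rfl; simp at hn
  have := (ℝ ∙ n).finrank_add_finrank_orthogonal
  rw [finrank_span_singleton hn0, finrank_euclideanSpace_fin] at this
  omega

theorem isometry_hyperplane {d : ℕ} (n : Eu d) (c : ℝ) :
    Isometry (fun y : (ℝ ∙ n)ᗮ => (y : Eu d) + c • n) :=
  (IsometryEquiv.addRight (c • n)).isometry.comp isometry_subtype_coe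

/-- The surface measure on a hyperplane is the image of the Lebesgue measure on its direction. -/
theorem map_volume_hyperplane {d : ℕ} {n : Eu d} (hn : ‖n‖ = 1) (c : ℝ) :
    (volume : Measure (ℝ ∙ n)ᗮ).map (fun y : (ℝ ∙ n)ᗮ => (y : Eu d) + c • n)
      = (μHE[d - 1] : Measure (Eu d)).restrict {x | ⟪n, x⟫ = c} := by
  have hrange : range (fun y : (ℝ ∙ n)ᗮ => (y : Eu d) + c • n) = {x | ⟪n, x⟫ = c} := by
    ext x
    constructor
    · rintro ⟨y, rfl⟩
      have := Submodule.mem_orthogonal_singleton_iff_inner_right.1 y.2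
      simp [inner_add_right, inner_smul_right, this, hn]
    · intro hx
      refine ⟨⟨x - c • n, ?_⟩, by simp⟩
      rw [Submodule.mem_orthogonal_singleton_iff_inner_right]
      simp only [mem_ofPred_eq] at hx
      simp [inner_sub_right, inner_smul_right, hx, hn]
  rw [← hrange, ← (isometry_hyperplane n c).map_euclideanHausdorffMeasure,
    ← finrank_orthogonal_span_singleton_eu hn,
    InnerProductSpace.euclideanHausdorffMeasure_eq_volume]

/-- These coordinates allow Fubini along the normal; the shift by `c • n` places the bounding
hyperplane at first coordinate zero. -/
theorem measurePreserving_normal_coordinates {d : ℕ} {n : Eu d} (hn : ‖n‖ = 1) (c : ℝ) :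
    MeasurePreserving (fun p : ℝ × (ℝ ∙ n)ᗮ => (p.1 • n + (p.2 : Eu d)) + c • n)
      (volume.prod volume) volume := by
  have h1 : MeasurePreserving ((ℝ ∙ n).measurableEquivProd (c • n)).symm
      ((volume : Measure (ℝ ∙ n)).prod (volume : Measure (ℝ ∙ n)ᗮ)) (volume : Measure (Eu d)) := by
    have := ((ℝ ∙ n).measurePreserving_measurableEquivProd (c • n)).symm
    rwa [InnerProductSpace.euclideanHausdorffMeasure_eq_volume, Measure.volume_eq_prod] at this
  have h2 : MeasurePreserving (LinearIsometryEquiv.toSpanUnitSingleton n hn : ℝ ≃ₗᵢ[ℝ] (ℝ ∙ n))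
      (volume : Measure ℝ) (volume : Measure (ℝ ∙ n)) :=
    LinearIsometryEquiv.measurePreserving _
  have h3 := h2.prod (MeasurePreserving.id (volume : Measure (ℝ ∙ n)ᗮ))
  have h4 := h1.comp h3
  have h5 : (fun p : ℝ × (ℝ ∙ n)ᗮ => (p.1 • n + (p.2 : Eu d)) + c • n) =
      ((ℝ ∙ n).measurableEquivProd (c • n)).symm ∘
      (Prod.map (LinearIsometryEquiv.toSpanUnitSingleton n hn) id) := by
    funext p
    rw [Function.comp_apply, Submodule.measurableEquivProd_symm_apply]
    simp
  rw [h5]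
  exact h4

/-- The fundamental theorem of calculus on a half-space: the integral of the outward normal
derivative of a compactly supported function is its integral over the bounding hyperplane. -/
theorem integral_halfSpace_fderiv {d : ℕ} {n : Eu d} (hn : ‖n‖ = 1) (c : ℝ) {g : Eu d → ℝ}
    (hg : ContDiff ℝ 1 g) (hc : HasCompactSupport g) :
    ∫ x in {x | ⟪n, x⟫ < c}, fderiv ℝ g x n
      = ∫ x in {x | ⟪n, x⟫ = c}, g x ∂(μHE[d - 1] : Measure (Eu d)) := by
  have hH : MeasurableSet {x : Eu d | ⟪n, x⟫ < c} :=
    (isOpen_lt (by fun_prop) continuous_const).measurableSet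
  have hΦ := measurePreserving_normal_coordinates hn c
  have hcont : Continuous (fun x => fderiv ℝ g x n) := by
    have := hg.continuous_fderiv one_ne_zero
    fun_prop
  have hF : Integrable ({x : Eu d | ⟪n, x⟫ < c}.indicator (fun x => fderiv ℝ g x n)) := by
    refine (hcont.integrable_of_hasCompactSupport ?_).indicator hH
    exact (hc.fderiv (𝕜 := ℝ)).comp_left (g := fun L : Eu d →L[ℝ] ℝ => L n) rfl
  rw [← map_volume_hyperplane hn, (isometry_hyperplane n c).isClosedEmbedding.measurableEmbedding.integral_map,
    ← integral_indicator hH, ← hΦ.map_eq, integral_map hΦ.aemeasurable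
      (by rw [hΦ.map_eq]; exact hF.aestronglyMeasurable)]
  refine (integral_prod_symm _ ((hΦ.integrable_comp hF.aestronglyMeasurable).2 hF)).trans ?_
  congr 1 with y
  have hny : ⟪n, (y : Eu d)⟫ = (0 : ℝ) :=
    Submodule.mem_orthogonal_singleton_iff_inner_right.1 y.2
  have hcurve : ∀ t : ℝ, HasDerivAt (fun t : ℝ => t • n + (y : Eu d) + c • n) n t := fun t => by
    simpa using (((hasDerivAt_id t).smul_const n).add_const (y : Eu d)).add_const (c • n)
  have hderiv : ∀ t : ℝ, HasDerivAt (fun t : ℝ => g (t • n + (y : Eu d) + c • n))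
      (fderiv ℝ g (t • n + (y : Eu d) + c • n) n) t := fun t =>
    ((hg.differentiable one_ne_zero _).hasFDerivAt).comp_hasDerivAt t (hcurve t)
  have hsupp : HasCompactSupport (fun t : ℝ => g (t • n + (y : Eu d) + c • n)) := by
    refine hc.comp_isClosedEmbedding (g := fun t : ℝ => t • n + (y : Eu d) + c • n) ?_
    refine Isometry.isClosedEmbedding (Isometry.of_dist_eq fun s t => ?_)
    rw [dist_add_right, dist_add_right, dist_eq_norm, ← sub_smul, norm_smul, hn, mul_one,
      dist_eq_norm]
  have hcd : ContDiff ℝ 1 (fun t : ℝ => g (t • n + (y : Eu d) + c • n)) := by fun_prop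
  -- On each normal line the half-space is `t < 0`, so the one-dimensional fundamental theorem
  -- leaves only the value at `t = 0`.
  have key := hsupp.integral_Iic_deriv_eq hcd 0
  rw [integral_Iic_eq_integral_Iio, ← integral_indicator measurableSet_Iio] at key
  simp only [zero_smul, zero_add] at key
  rw [← key]
  congr 1 with t
  simp only [indicator_apply]
  refine if_congr ?_ (hderiv t).deriv.symm rfl
  simp [inner_add_right, inner_smul_right, hny, hn]

end HalfSpace

/-! ### Polytopes near the relative interior of a facet. -/

section PolytopeGeometry

variable {d : ℕ}

namespace Polytope

variable {K : Polytope d} {e : Set (Eu d)}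

theorem mem_carrier {x : Eu d} :
    x ∈ K.carrier ↔ ∀ e ∈ K.facets, ⟪K.normal e, x⟫ ≤ K.offset e := by
  conv_lhs => rw [K.carrier_eq]
  rfl

theorem mem_facet (he : e ∈ K.facets) {x : Eu d} :
    x ∈ e ↔ x ∈ K.carrier ∧ ⟪K.normal e, x⟫ = K.offset e := by
  conv_lhs => rw [K.facet_eq e he]
  rfl

theorem facet_subset (he : e ∈ K.facets) : e ⊆ K.carrier := fun _ hx => ((mem_facet he).1 hx).1

theorem isClosed_carrier (K : Polytope d) : IsClosed K.carrier := by
  have : K.carrier = ⋂ e ∈ K.facets, {x | ⟪K.normal e, x⟫ ≤ K.offset e} := by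
    ext x; simp [mem_carrier]
  rw [this]
  exact isClosed_biInter fun e _ => isClosed_le (by fun_prop) continuous_const

theorem convex_carrier (K : Polytope d) : Convex ℝ K.carrier := by
  have : K.carrier = ⋂ e ∈ K.facets, {x | ⟪K.normal e, x⟫ ≤ K.offset e} := by
    ext x; simp [mem_carrier]
  rw [this]
  exact convex_iInter₂ fun e _ => convex_halfSpace_le (innerSL ℝ (K.normal e)).isLinear _

theorem isClosed_facet (he : e ∈ K.facets) : IsClosed e := by
  have : e = K.carrier ∩ {x | ⟪K.normal e, x⟫ = K.offset e} := by
    ext x; exact mem_facet he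
  rw [this]
  exact K.isClosed_carrier.inter (isClosed_eq (by fun_prop) continuous_const)

theorem isCompact_facet (he : e ∈ K.facets) : IsCompact e :=
  Metric.isCompact_of_isClosed_isBounded (isClosed_facet he) (K.bounded.subset (facet_subset he))

theorem isOpen_dom (K : Polytope d) : IsOpen K.dom := isOpen_interior

theorem dom_subset (K : Polytope d) : K.dom ⊆ K.carrier := interior_subset

theorem inner_normal_self (he : e ∈ K.facets) : ⟪K.normal e, K.normal e⟫ = (1 : ℝ) := by
  rw [real_inner_self_eq_norm_sq, K.norm_normal e he, one_pow]

/-- An interior point can be pushed a little along any `normal e` without leaving `K`, so no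
constraint is tight there; conversely the strict inequalities cut out an open set. -/
theorem mem_dom {x : Eu d} : x ∈ K.dom ↔ ∀ e ∈ K.facets, ⟪K.normal e, x⟫ < K.offset e := by
  constructor
  · intro hx e he
    have hc : Filter.Tendsto (fun ε : ℝ => x + ε • K.normal e) (nhdsWithin 0 (Ioi 0))
        (nhds x) := by
      have : Continuous fun ε : ℝ => x + ε • K.normal e := by fun_prop
      simpa using (this.tendsto 0).mono_left nhdsWithin_le_nhds
    have hev := hc.eventually (K.isOpen_dom.mem_nhds hx)
    obtain ⟨ε, h1, h2⟩ := (hev.and self_mem_nhdsWithin).exists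
    have h3 := mem_carrier.1 (K.dom_subset h1) e he
    rw [inner_add_right, inner_smul_right, inner_normal_self he] at h3
    have : (0 : ℝ) < ε := h2
    linarith
  · intro hx
    have : IsOpen (⋂ e ∈ K.facets, {x : Eu d | ⟪K.normal e, x⟫ < K.offset e}) :=
      isOpen_biInter_finset fun e _ => isOpen_lt (by fun_prop) continuous_const
    refine interior_maximal (fun y hy => ?_) this (by simpa using hx)
    simp only [mem_iInter, mem_ofPred_eq] at hy
    exact mem_carrier.2 fun e he => (hy e he).le

theorem exists_facet_of_mem_carrier {x : Eu d} (hx : x ∈ K.carrier) (hx' : x ∉ K.dom) :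
    ∃ e ∈ K.facets, x ∈ e := by
  simp only [mem_dom, not_forall, not_lt] at hx'
  obtain ⟨e, he, h⟩ := hx'
  exact ⟨e, he, (mem_facet he).2 ⟨hx, le_antisymm (mem_carrier.1 hx e he) h⟩⟩

theorem volume_carrier_diff_dom (K : Polytope d) : volume (K.carrier \ K.dom) = 0 := by
  have := K.convex_carrier.addHaar_frontier (volume : Measure (Eu d))
  rwa [K.isClosed_carrier.frontier_eq] at this

theorem dom_mono {L : Polytope d} (h : K.carrier ⊆ L.carrier) : K.dom ⊆ L.dom := interior_mono h

/-- The open set of points strictly on the inner side of all facets but `e`. -/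
def facetNhd (K : Polytope d) (e : Set (Eu d)) : Set (Eu d) :=
  {x | ∀ e' ∈ K.facets, e' ≠ e → ⟪K.normal e', x⟫ < K.offset e'}

theorem isOpen_facetNhd (K : Polytope d) (e : Set (Eu d)) : IsOpen (K.facetNhd e) := by
  classical
  have : K.facetNhd e = ⋂ e' ∈ K.facets.erase e,
      {x : Eu d | ⟪K.normal e', x⟫ < K.offset e'} := by
    ext x
    simp only [facetNhd, mem_ofPred_eq, mem_iInter, Finset.mem_erase]
    exact ⟨fun h i hi => h i hi.2 hi.1, fun h i h1 h2 => h i ⟨h2, h1⟩⟩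
  rw [this]
  exact isOpen_biInter_finset fun e _ => isOpen_lt (by fun_prop) continuous_const

/-- Within `facetNhd e` the polytope is a half-space; this and the next two lemmas reduce the
analysis near a facet to that case. -/
theorem mem_carrier_of_facetNhd {x : Eu d} (he : e ∈ K.facets) (hx : x ∈ K.facetNhd e) :
    x ∈ K.carrier ↔ ⟪K.normal e, x⟫ ≤ K.offset e := by
  rw [mem_carrier]
  refine ⟨fun h => h e he, fun h e' he' => ?_⟩
  by_cases h1 : e' = e
  · rwa [h1]
  · exact (hx e' he' h1).le

theorem mem_dom_of_facetNhd {x : Eu d} (he : e ∈ K.facets) (hx : x ∈ K.facetNhd e) :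
    x ∈ K.dom ↔ ⟪K.normal e, x⟫ < K.offset e := by
  rw [mem_dom]
  refine ⟨fun h => h e he, fun h e' he' => ?_⟩
  by_cases h1 : e' = e
  · rwa [h1]
  · exact hx e' he' h1

theorem mem_facet_of_facetNhd {x : Eu d} (he : e ∈ K.facets) (hx : x ∈ K.facetNhd e) :
    x ∈ e ↔ ⟪K.normal e, x⟫ = K.offset e := by
  rw [mem_facet he, mem_carrier_of_facetNhd he hx]
  exact ⟨fun h => h.2, fun h => ⟨h.le, h⟩⟩

theorem notMem_of_facetNhd {x : Eu d} {e' : Set (Eu d)} (he' : e' ∈ K.facets) (h : e' ≠ e)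
    (hx : x ∈ K.facetNhd e) : x ∉ e' := fun hx' =>
  (hx e' he' h).ne ((mem_facet he').1 hx').2

theorem mem_facetNhd_of_forall_notMem {x : Eu d} (hx : x ∈ K.carrier)
    (h : ∀ e' ∈ K.facets, e' ≠ e → x ∉ e') : x ∈ K.facetNhd e := fun e' he' hne =>
  lt_of_le_of_ne (mem_carrier.1 hx e' he') fun h' => h e' he' hne ((mem_facet he').2 ⟨hx, h'⟩)

theorem eventually_add_smul_mem {U : Set (Eu d)} (hU : IsOpen U) {x : Eu d} (hx : x ∈ U)
    (v : Eu d) : ∀ᶠ ε : ℝ in nhdsWithin 0 (Ioi 0), x + ε • v ∈ U := by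
  have hc : Filter.Tendsto (fun ε : ℝ => x + ε • v) (nhdsWithin 0 (Ioi 0)) (nhds x) := by
    have : Continuous fun ε : ℝ => x + ε • v := by fun_prop
    simpa using (this.tendsto 0).mono_left nhdsWithin_le_nhds
  exact hc.eventually (hU.mem_nhds hx)

theorem eventually_mem_dom {x v : Eu d} (he : e ∈ K.facets) (hx : x ∈ e)
    (hx' : x ∈ K.facetNhd e) (hv : ⟪K.normal e, v⟫ < 0) :
    ∀ᶠ ε : ℝ in nhdsWithin 0 (Ioi 0), x + ε • v ∈ K.dom := by
  filter_upwards [eventually_add_smul_mem (K.isOpen_facetNhd e) hx' v, self_mem_nhdsWithin]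
    with ε h1 h2
  rw [mem_dom_of_facetNhd he h1, inner_add_right, inner_smul_right, ((mem_facet he).1 hx).2]
  have : (0 : ℝ) < ε := h2
  nlinarith

theorem inner_lt_one_of_ne {a b : Eu d} (ha : ‖a‖ = 1) (hb : ‖b‖ = 1) (h : a ≠ b) :
    ⟪a, b⟫ < 1 := inner_lt_one_iff_real_of_norm_eq_one ha hb |>.2 h

/-- Two polytopes with disjoint interiors have opposite normals at a common point of the relative
interiors of two facets. -/
theorem normal_eq_neg {L : Polytope d} {e' : Set (Eu d)} (hKL : Disjoint K.dom L.dom)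
    (he : e ∈ K.facets) (he' : e' ∈ L.facets) {x : Eu d} (hx : x ∈ e) (hx' : x ∈ e')
    (hK : x ∈ K.facetNhd e) (hL : x ∈ L.facetNhd e') : L.normal e' = - K.normal e := by
  by_contra hne
  have h1 : ⟪K.normal e, - L.normal e'⟫ < 1 := by
    refine inner_lt_one_of_ne (K.norm_normal e he) (by rw [norm_neg, L.norm_normal e' he']) ?_
    rintro h
    exact hne (by rw [h, neg_neg])
  rw [inner_neg_right] at h1
  -- Unless the normals are opposite, the direction `-(n + n')` points strictly into both polytopes,
  -- whose interiors would then meet.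
  have k1 : ⟪K.normal e, -(K.normal e + L.normal e')⟫ < 0 := by
    rw [inner_neg_right, inner_add_right, inner_normal_self he]; linarith
  have k2 : ⟪L.normal e', -(K.normal e + L.normal e')⟫ < 0 := by
    rw [inner_neg_right, inner_add_right, inner_normal_self he', real_inner_comm]; linarith
  obtain ⟨ε, hε⟩ := ((eventually_mem_dom he hx hK k1).and (eventually_mem_dom he' hx' hL k2)).exists
  exact hKL.notMem_of_mem_left hε.1 hε.2

theorem offset_eq_neg {L : Polytope d} {e' : Set (Eu d)} (he : e ∈ K.facets) (he' : e' ∈ L.facets)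
    {x : Eu d} (hx : x ∈ e) (hx' : x ∈ e') (h : L.normal e' = - K.normal e) :
    L.offset e' = - K.offset e := by
  rw [← ((mem_facet he).1 hx).2, ← ((mem_facet he').1 hx').2, h, inner_neg_left]

/-- A facet of the larger polytope through a point in the relative interior of a facet of the
smaller polytope has the same normal. -/
theorem normal_eq_of_subset {P : Polytope d} {F : Set (Eu d)} (hKP : K.carrier ⊆ P.carrier)
    (he : e ∈ K.facets) (hF : F ∈ P.facets) {x : Eu d} (hx : x ∈ e) (hxF : x ∈ F)
    (hK : x ∈ K.facetNhd e) : P.normal F = K.normal e := by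
  by_contra hne
  have h1 := inner_lt_one_of_ne (P.norm_normal F hF) (K.norm_normal e he) hne
  -- If the normals differ, the direction `n_F - n_e` enters `K` but leaves `P`.
  have k1 : ⟪K.normal e, P.normal F - K.normal e⟫ < 0 := by
    rw [inner_sub_right, inner_normal_self he, real_inner_comm]; linarith
  have k2 : 0 < ⟪P.normal F, P.normal F - K.normal e⟫ := by
    rw [inner_sub_right, inner_normal_self hF]; linarith
  obtain ⟨ε, hε, hpos⟩ := ((eventually_mem_dom he hx hK k1).and self_mem_nhdsWithin).exists
  have h2 := mem_carrier.1 (hKP (K.dom_subset hε)) F hF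
  rw [inner_add_right, inner_smul_right, ((mem_facet hF).1 hxF).2] at h2
  have : (0 : ℝ) < ε := hpos
  nlinarith

theorem offset_eq_of_normal_eq {P : Polytope d} {F : Set (Eu d)} (he : e ∈ K.facets)
    (hF : F ∈ P.facets) {x : Eu d} (hx : x ∈ e) (hxF : x ∈ F) (h : P.normal F = K.normal e) :
    P.offset F = K.offset e := by
  rw [← ((mem_facet he).1 hx).2, ← ((mem_facet hF).1 hxF).2, h]

/-- In the hyperplane the surface measure is Lebesgue measure and the facet is compact. Finiteness
puts test functions in `L²(e)` and `L²(e)` in `L¹(e)`. -/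
theorem measure_facet_lt_top (he : e ∈ K.facets) : (μHE[d - 1] : Measure (Eu d)) e < ⊤ := by
  have hsub : e ⊆ {x | ⟪K.normal e, x⟫ = K.offset e} := fun x hx => ((mem_facet he).1 hx).2
  rw [← Measure.restrict_eq_self _ hsub, ← map_volume_hyperplane (K.norm_normal e he),
    (isometry_hyperplane _ _).isClosedEmbedding.measurableEmbedding.map_apply]
  exact ((isometry_hyperplane _ _).isClosedEmbedding.isCompact_preimage
    (isCompact_facet he)).measure_lt_top

instance isFiniteMeasure_facet (e : K.facets) :
    IsFiniteMeasure ((μHE[d - 1] : Measure (Eu d)).restrict (e : Set (Eu d))) :=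
  ⟨by rw [Measure.restrict_apply_univ]; exact measure_facet_lt_top e.2⟩

end Polytope

end PolytopeGeometry

/-! ### Green's formulas and their localization to a facet. -/

section Green

variable {d : ℕ}

theorem inner_toLp_left {F : Type*} [NormedAddCommGroup F] [InnerProductSpace ℝ F]
    {μ : Measure (Eu d)} {f : Eu d → F} (hf : MemLp f 2 μ) (g : Lp F 2 μ) :
    (inner ℝ (hf.toLp f) g : ℝ) = ∫ x, ⟪f x, g x⟫ ∂μ := by
  rw [L2.inner_def]
  refine integral_congr_ae ?_
  filter_upwards [hf.coeFn_toLp] with x hx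
  rw [hx]

theorem integrable_inner_left {F : Type*} [NormedAddCommGroup F] [InnerProductSpace ℝ F]
    {μ : Measure (Eu d)} {f : Eu d → F} (hf : MemLp f 2 μ) (g : Lp F 2 μ) :
    Integrable (fun x => ⟪f x, g x⟫) μ := by
  refine (L2.integrable_inner (𝕜 := ℝ) (hf.toLp f) g).congr ?_
  filter_upwards [hf.coeFn_toLp] with x hx
  rw [hx]

theorem integral_zeroLp_mul (μ : Measure (Eu d)) (f : Eu d → ℝ) :
    ∫ x, ((0 : Lp ℝ 2 μ) : Eu d → ℝ) x * f x ∂μ = 0 := by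
  refine integral_eq_zero_of_ae ?_
  filter_upwards [Lp.coeFn_zero ℝ 2 μ] with x hx
  rw [hx]
  simp

/-- Green's formula. -/
theorem HDiv.green {K : Polytope d} (v : HDiv K) (w : H1 K) :
    (inner ℝ (HDiv.val v) (H1.grad w) : ℝ) + inner ℝ (HDiv.div v) (H1.val w)
      = ∑ e : K.facets, inner ℝ (HDiv.ntr v e) (H1.tr w e) := by
  -- On smooth triples the identity is the definition of `HDiv`; being a closed condition, it passes
  -- to the closure `H1`.
  have hcl : IsClosed {x : L2 K × L2Vec K × L2Bdry K |
      (inner ℝ (HDiv.val v) x.2.1 : ℝ) + inner ℝ (HDiv.div v) x.1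
        = ∑ e : K.facets, inner ℝ (HDiv.ntr v e) (x.2.2 e)} := by
    refine isClosed_eq ?_ ?_
    · exact (continuous_const.inner continuous_snd.fst).add (continuous_const.inner continuous_fst)
    · exact continuous_finsetSum _ fun e _ =>
        continuous_const.inner ((continuous_apply e).comp continuous_snd.snd)
  exact closure_minimal (fun x hx => v.2 x hx) hcl w.2

theorem fderiv_mul_apply {φ ψ : Eu d → ℝ} (hφ : ContDiff ℝ ∞ φ) (hψ : ContDiff ℝ ∞ ψ)
    (n x : Eu d) :
    fderiv ℝ (fun y => φ y * ψ y) x n = φ x * fderiv ℝ ψ x n + ψ x * fderiv ℝ φ x n := by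
  rw [fderiv_fun_mul (hφ.differentiable (by simp) x) (hψ.differentiable (by simp) x)]
  simp

theorem inner_gradient_right {ψ : Eu d → ℝ} (n x : Eu d) :
    ⟪n, gradient ψ x⟫ = fderiv ℝ ψ x n := by
  rw [real_inner_comm, gradient, InnerProductSpace.toDual_symm_apply]

theorem memLp_smul_const {φ : Eu d → ℝ} (hφ : Continuous φ) (hc : HasCompactSupport φ)
    (n : Eu d) (μ : Measure (Eu d)) [IsFiniteMeasureOnCompacts μ] :
    MemLp (fun x => φ x • n) 2 μ :=
  (hφ.smul continuous_const).memLp_of_hasCompactSupport (hc.smul_right (f' := fun _ => n))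

theorem hasCompactSupport_fderiv_apply {φ : Eu d → ℝ} (hc : HasCompactSupport φ) (n : Eu d) :
    HasCompactSupport (fun x => fderiv ℝ φ x n) :=
  (hc.fderiv (𝕜 := ℝ)).comp_left (g := fun L : Eu d →L[ℝ] ℝ => L n) rfl

theorem continuous_fderiv_apply_const {φ : Eu d → ℝ} (hφ : ContDiff ℝ ∞ φ) (n : Eu d) :
    Continuous (fun x => fderiv ℝ φ x n) := by
  have := hφ.continuous_fderiv (by simp)
  fun_prop

theorem memLp_fderiv_apply {φ : Eu d → ℝ} (hφ : ContDiff ℝ ∞ φ) (hc : HasCompactSupport φ)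
    (n : Eu d) (μ : Measure (Eu d)) [IsFiniteMeasureOnCompacts μ] :
    MemLp (fun x => fderiv ℝ φ x n) 2 μ :=
  (continuous_fderiv_apply_const hφ n).memLp_of_hasCompactSupport
    (hasCompactSupport_fderiv_apply hc n)

/-- If the constant direction `n` cut off by `φ` satisfies Green's formula on `K` for all smooth
functions, with normal trace `t`, then it does so for all functions in `H¹(K)`. -/
theorem green_smul_const {K : Polytope d} {φ : Eu d → ℝ} (hφ : ContDiff ℝ ∞ φ)
    (hc : HasCompactSupport φ) (n : Eu d) (t : L2Bdry K)
    (H : ∀ ψ : Eu d → ℝ, ContDiff ℝ ∞ ψ → ∫ x in K.dom, fderiv ℝ (fun y => φ y * ψ y) x n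
      = ∑ e : K.facets, ∫ x in (e : Set (Eu d)), t e x * ψ x ∂(μHE[d - 1] : Measure (Eu d)))
    (w : H1 K) :
    ∫ x in K.dom, (φ x * ⟪n, H1.grad w x⟫ + fderiv ℝ φ x n * H1.val w x)
      = ∑ e : K.facets, inner ℝ (t e) (H1.tr w e) := by
  have hm1 := memLp_smul_const hφ.continuous hc n (volume.restrict K.dom)
  have hm2 := memLp_fderiv_apply hφ hc n (volume.restrict K.dom)
  -- The field `φ n`, with divergence `∂φ/∂n` and normal trace `t`, is an element of `HDiv K`, so
  -- the formula for `H1` applies to it.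
  have hmem : (hm1.toLp _, hm2.toLp _, t) ∈ HDiv K := by
    rintro x ⟨ψ, hψ, h1, h2, h3⟩
    change (inner ℝ (hm1.toLp _) x.2.1 : ℝ) + inner ℝ (hm2.toLp _) x.1
      = ∑ e : K.facets, inner ℝ (t e) (x.2.2 e)
    rw [inner_toLp_left, inner_toLp_left, ← integral_add (integrable_inner_left hm1 _)
      (integrable_inner_left hm2 _)]
    trans ∫ x in K.dom, fderiv ℝ (fun y => φ y * ψ y) x n
    · refine integral_congr_ae ?_
      filter_upwards [h1, h2] with y k1 k2
      rw [fderiv_mul_apply hφ hψ, k1, k2, real_inner_smul_left, inner_gradient_right]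
      simp
    · rw [H ψ hψ]
      refine Finset.sum_congr rfl fun e _ => ?_
      rw [L2.inner_def]
      refine integral_congr_ae ?_
      filter_upwards [h3 e] with y k3
      rw [k3]
      simp [mul_comm]
  have := HDiv.green ⟨_, hmem⟩ w
  change (inner ℝ (hm1.toLp _) (H1.grad w) : ℝ) + inner ℝ (hm2.toLp _) (H1.val w)
      = ∑ e : K.facets, inner ℝ (t e) (H1.tr w e) at this
  rw [← this, inner_toLp_left, inner_toLp_left, ← integral_add (integrable_inner_left hm1 _)
      (integrable_inner_left hm2 _)]
  refine integral_congr_ae (Filter.Eventually.of_forall fun x => ?_)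
  simp [real_inner_smul_left, mul_comm]

theorem setIntegral_eq_of_inter_eq {F : Type*} [NormedAddCommGroup F] [NormedSpace ℝ F]
    {μ : Measure (Eu d)} {A B U : Set (Eu d)} (hA : MeasurableSet A)
    (hB : MeasurableSet B) {f : Eu d → F} (hAB : ∀ x ∈ U, x ∈ A ↔ x ∈ B)
    (hf : ∀ x ∉ U, f x = 0) : ∫ x in A, f x ∂μ = ∫ x in B, f x ∂μ := by
  classical
  rw [← integral_indicator hA, ← integral_indicator hB]
  refine integral_congr_ae (Filter.Eventually.of_forall fun x => ?_)
  by_cases hx : x ∈ U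
  · simp only [indicator_apply, hAB x hx]
  · simp [indicator_apply, hf x hx]

theorem fderiv_apply_eq_zero_of_notMem {φ ψ : Eu d → ℝ} {n x : Eu d}
    (hx : x ∉ tsupport φ) : fderiv ℝ (fun y => φ y * ψ y) x n = 0 := by
  have : (fun y => φ y * ψ y) =ᶠ[nhds x] fun _ => 0 := by
    filter_upwards [notMem_tsupport_iff_eventuallyEq.1 hx] with y hy
    simp [hy]
  rw [this.fderiv_eq]
  simp

/-- Green's formula for a field which is normal to the facet `e` and supported away from the other
facets. -/
theorem green_facet {K : Polytope d} {φ : Eu d → ℝ} (hφ : ContDiff ℝ ∞ φ)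
    (hc : HasCompactSupport φ) (e : K.facets) (hs : tsupport φ ⊆ K.facetNhd e) (w : H1 K) :
    ∫ x in K.dom, (φ x * ⟪K.normal e, H1.grad w x⟫ + fderiv ℝ φ x (K.normal e) * H1.val w x)
      = ∫ x in (e : Set (Eu d)), φ x * H1.tr w e x ∂(μHE[d - 1] : Measure (Eu d)) := by
  classical
  have hm := hφ.continuous.memLp_of_hasCompactSupport (p := 2)
    (μ := (μHE[d - 1] : Measure (Eu d)).restrict (e : Set (Eu d))) hc
  -- The normal trace of `φ n` is `φ` on `e`, as `n` is a unit vector, and zero on the other facets,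
  -- which `tsupport φ` misses.
  rw [green_smul_const hφ hc (K.normal e) (Pi.single e (hm.toLp φ)) ?_ w]
  · rw [Finset.sum_eq_single e, Pi.single_eq_same, inner_toLp_left]
    · simp [mul_comm]
    · intro e' _ h
      rw [Pi.single_eq_of_ne h, inner_zero_left]
    · simp
  · intro ψ hψ
    rw [Finset.sum_eq_single e, Pi.single_eq_same]
    · have h1 : ∫ x in K.dom, fderiv ℝ (fun y => φ y * ψ y) x (K.normal e)
          = ∫ x in {x | ⟪K.normal e, x⟫ < K.offset e},
              fderiv ℝ (fun y => φ y * ψ y) x (K.normal e) := by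
        refine setIntegral_eq_of_inter_eq (U := K.facetNhd e) K.isOpen_dom.measurableSet
          (isOpen_lt (by fun_prop) continuous_const).measurableSet
          (fun x hx => Polytope.mem_dom_of_facetNhd e.2 hx)
          fun x hx => fderiv_apply_eq_zero_of_notMem fun h => hx (hs h)
      rw [h1, integral_halfSpace_fderiv (K.norm_normal e e.2) _
        ((hφ.mul hψ).of_le (by simp)) hc.mul_right]
      rw [setIntegral_eq_of_inter_eq (U := K.facetNhd e) (B := (e : Set (Eu d)))
        (isClosed_eq (by fun_prop) continuous_const).measurableSet
        (Polytope.isClosed_facet e.2).measurableSet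
        (fun x hx => (Polytope.mem_facet_of_facetNhd e.2 hx).symm)
        fun x hx => by rw [image_eq_zero_of_notMem_tsupport fun h => hx (hs h), zero_mul]]
      refine integral_congr_ae ?_
      filter_upwards [hm.coeFn_toLp] with x hx
      rw [hx]
    · intro e' _ h
      rw [Pi.single_eq_of_ne h]
      exact integral_zeroLp_mul _ _
    · simp

/-- Green's formula for a field supported in the interior. -/
theorem green_interior {K : Polytope d} {φ : Eu d → ℝ} (hφ : ContDiff ℝ ∞ φ)
    (hc : HasCompactSupport φ) (n : Eu d) (hs : tsupport φ ⊆ K.dom) (w : H1 K) :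
    ∫ x in K.dom, (φ x * ⟪n, H1.grad w x⟫ + fderiv ℝ φ x n * H1.val w x) = 0 := by
  rw [green_smul_const hφ hc n 0 ?_ w]
  · simp
  · intro ψ hψ
    have hφψ : ContDiff ℝ ∞ (fun y => φ y * ψ y) := hφ.mul hψ
    have hcc : HasCompactSupport (fun y => φ y * ψ y) := hc.mul_right
    rw [setIntegral_eq_integral_of_forall_compl_eq_zero
      fun x hx => fderiv_apply_eq_zero_of_notMem fun h => hx (hs h)]
    have hi1 := (continuous_fderiv_apply_const hφψ n).integrable_of_hasCompactSupport
      (μ := (volume : Measure (Eu d))) (hasCompactSupport_fderiv_apply hcc n)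
    have hi2 := hφψ.continuous.integrable_of_hasCompactSupport (μ := (volume : Measure (Eu d))) hcc
    -- Integration by parts against the constant one: a directional derivative of a compactly
    -- supported function has integral zero.
    have := integral_mul_fderiv_eq_neg_fderiv_mul_of_integrable (μ := (volume : Measure (Eu d)))
      (f := fun _ => (1 : ℝ)) (g := fun y => φ y * ψ y) (v := n) (by simp)
      (by simpa using hi1) (by simpa using hi2)
      (fun x _ => differentiableAt_const (1 : ℝ)) (fun x _ => hφψ.differentiable (by simp) x)
    simp only [one_mul] at this
    rw [this]
    simp only [fderiv_const_apply, Pi.zero_apply]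
    symm
    simp only [zero_apply, zero_mul, integral_zero, neg_zero]
    exact Finset.sum_eq_zero fun e _ => integral_zeroLp_mul _ _

/-- The defining identity of the normal trace, for compactly supported test functions. -/
theorem HDiv.green_test {K : Polytope d} (v : HDiv K) {φ : Eu d → ℝ} (hφ : ContDiff ℝ ∞ φ)
    (hc : HasCompactSupport φ) :
    ∫ x in K.dom, (⟪HDiv.val v x, gradient φ x⟫ + HDiv.div v x * φ x)
      = ∑ e : K.facets, ∫ x in (e : Set (Eu d)), φ x * HDiv.ntr v e x
          ∂(μHE[d - 1] : Measure (Eu d)) := by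
  have hgc : Continuous (gradient φ) :=
    (InnerProductSpace.toDual ℝ (Eu d)).symm.continuous.comp (hφ.continuous_fderiv (by simp))
  have hgs : HasCompactSupport (gradient φ) :=
    (hc.fderiv (𝕜 := ℝ)).comp_left (g := (InnerProductSpace.toDual ℝ (Eu d)).symm) (map_zero _)
  have hm1 := hφ.continuous.memLp_of_hasCompactSupport (p := 2) (μ := volume.restrict K.dom) hc
  have hm2 := hgc.memLp_of_hasCompactSupport (p := 2) (μ := volume.restrict K.dom) hgs
  have hm3 : ∀ e : K.facets, MemLp φ 2
      ((μHE[d - 1] : Measure (Eu d)).restrict (e : Set (Eu d))) := fun e =>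
    hφ.continuous.memLp_of_hasCompactSupport hc
  have := v.2 (hm1.toLp _, hm2.toLp _, fun e => (hm3 e).toLp _)
    ⟨φ, hφ, hm1.coeFn_toLp, hm2.coeFn_toLp, fun e => (hm3 e).coeFn_toLp⟩
  change (inner ℝ (HDiv.val v) (hm2.toLp _) : ℝ) + inner ℝ (HDiv.div v) (hm1.toLp _)
    = ∑ e : K.facets, inner ℝ (HDiv.ntr v e) ((hm3 e).toLp _) at this
  rw [real_inner_comm, real_inner_comm (hm1.toLp _), inner_toLp_left, inner_toLp_left,
    ← integral_add (integrable_inner_left hm2 _) (integrable_inner_left hm1 _)] at this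
  convert this using 1
  · refine integral_congr_ae (Filter.Eventually.of_forall fun x => ?_)
    simp
  · refine Finset.sum_congr rfl fun e _ => ?_
    rw [real_inner_comm, inner_toLp_left]
    simp [mul_comm]

theorem gradient_eq_zero_of_notMem_tsupport {φ : Eu d → ℝ} {x : Eu d} (hx : x ∉ tsupport φ) :
    gradient φ x = 0 := by
  rw [gradient, image_eq_zero_of_notMem_tsupport fun h => hx (tsupport_fderiv_subset ℝ h), map_zero]

end Green

/-! ### Traces of restrictions on interfaces and on the boundary. -/

section Traces

variable {d : ℕ}

/-- The fundamental lemma of the calculus of variations for surface measure. Since `U` need only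
cover almost all of the facet, its relative boundary can be avoided. -/
theorem L2Face_eq_zero_of_test {K : Polytope d} {e : K.facets} {U : Set (Eu d)} (hU : IsOpen U)
    (hnull : (μHE[d - 1] : Measure (Eu d)) ((e : Set (Eu d)) \ U) = 0)
    (f : L2Face (e : Set (Eu d)))
    (h : ∀ φ : Eu d → ℝ, ContDiff ℝ ∞ φ → HasCompactSupport φ → tsupport φ ⊆ U →
      ∫ x in (e : Set (Eu d)), φ x * f x ∂(μHE[d - 1] : Measure (Eu d)) = 0) : f = 0 := by
  have hint : Integrable f ((μHE[d - 1] : Measure (Eu d)).restrict (e : Set (Eu d))) :=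
    (Lp.memLp f).integrable (by norm_num)
  have hae := hU.ae_eq_zero_of_integral_contDiff_smul_eq_zero
    (hint.locallyIntegrable.locallyIntegrableOn U) h
  have hUae : ∀ᵐ x ∂(μHE[d - 1] : Measure (Eu d)).restrict (e : Set (Eu d)), x ∈ U := by
    rw [ae_iff, Measure.restrict_apply' (Polytope.isClosed_facet e.2).measurableSet]
    refine measure_mono_null ?_ hnull
    rintro x ⟨h1, h2⟩
    exact ⟨h2, h1⟩
  rw [Lp.eq_zero_iff_ae_eq_zero]
  filter_upwards [hae, hUae] with x h1 h2
  exact h1 h2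

theorem setIntegral_eq_zero_of_disjoint_tsupport {μ : Measure (Eu d)} {A : Set (Eu d)}
    {φ : Eu d → ℝ} (hA : Disjoint A (tsupport φ)) (f : Eu d → ℝ) :
    ∫ x in A, φ x * f x ∂μ = 0 := by
  refine setIntegral_eq_zero_of_forall_eq_zero fun x hx => ?_
  rw [image_eq_zero_of_notMem_tsupport (hA.notMem_of_mem_left hx), zero_mul]

theorem Polytope.disjoint_facet_dom {K : Polytope d} {e : Set (Eu d)} (he : e ∈ K.facets) :
    Disjoint e K.dom := by
  rw [Set.disjoint_left]
  intro x hx hx'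
  exact (Polytope.mem_dom.1 hx' e he).ne ((Polytope.mem_facet he).1 hx).2

section Interface

variable {P K L : Polytope d} {e : Set (Eu d)}

theorem Polytope.inter_facetNhd_subset_union (heK : e ∈ K.facets) (heL : e ∈ L.facets)
    (hn : L.normal e = - K.normal e) (ho : L.offset e = - K.offset e) :
    K.facetNhd e ∩ L.facetNhd e ⊆ K.carrier ∪ L.carrier := by
  rintro x ⟨h1, h2⟩
  rcases le_total ⟪K.normal e, x⟫ (K.offset e) with h | h
  · exact Or.inl ((Polytope.mem_carrier_of_facetNhd heK h1).2 h)
  · refine Or.inr ((Polytope.mem_carrier_of_facetNhd heL h2).2 ?_)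
    rw [hn, ho, inner_neg_left]
    linarith

/-- An open set covered by two subsets of `P` lies in the interior of `P`; test functions supported
there do not see the boundary of `P`. -/
theorem Polytope.inter_facetNhd_subset_dom (hKP : K.carrier ⊆ P.carrier)
    (hLP : L.carrier ⊆ P.carrier) (heK : e ∈ K.facets) (heL : e ∈ L.facets)
    (hn : L.normal e = - K.normal e) (ho : L.offset e = - K.offset e) :
    K.facetNhd e ∩ L.facetNhd e ⊆ P.dom :=
  interior_maximal ((Polytope.inter_facetNhd_subset_union heK heL hn ho).trans
    (union_subset hKP hLP)) ((K.isOpen_facetNhd e).inter (L.isOpen_facetNhd e))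

/-- The support of `f` is covered by `K` and `L`, and the boundaries of convex sets are null. -/
theorem setIntegral_interface (hKP : K.carrier ⊆ P.carrier) (hLP : L.carrier ⊆ P.carrier)
    (hKL : Disjoint K.dom L.dom) (heK : e ∈ K.facets) (heL : e ∈ L.facets)
    (hn : L.normal e = - K.normal e) (ho : L.offset e = - K.offset e) {f : Eu d → ℝ}
    (hf : IntegrableOn f P.dom) (h0 : ∀ x ∉ K.facetNhd e ∩ L.facetNhd e, f x = 0) :
    ∫ x in P.dom, f x = (∫ x in K.dom, f x) + ∫ x in L.dom, f x := by
  have hK := Polytope.dom_mono hKP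
  have hL := Polytope.dom_mono hLP
  rw [← setIntegral_union hKL L.isOpen_dom.measurableSet (hf.mono_set hK) (hf.mono_set hL)]
  refine setIntegral_eq_of_subset_of_ae_sdiff_eq_zero P.isOpen_dom.measurableSet.nullMeasurableSet
    (union_subset hK hL) ?_
  have hnull : volume ((K.carrier \ K.dom) ∪ (L.carrier \ L.dom)) = 0 :=
    measure_union_null K.volume_carrier_diff_dom L.volume_carrier_diff_dom
  filter_upwards [measure_eq_zero_iff_ae_notMem.1 hnull] with x hx hx'
  refine h0 x fun hxU => hx ?_
  simp only [mem_sdiff, mem_union, not_or] at hx'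
  rcases Polytope.inter_facetNhd_subset_union heK heL hn ho hxU with h | h
  · exact Or.inl ⟨h, hx'.2.1⟩
  · exact Or.inr ⟨h, hx'.2.2⟩

theorem HDiv.integrableOn_test (q : HDiv P) {φ : Eu d → ℝ} (hφ : ContDiff ℝ ∞ φ)
    (hc : HasCompactSupport φ) :
    IntegrableOn (fun x => ⟪HDiv.val q x, gradient φ x⟫ + HDiv.div q x * φ x) P.dom := by
  have hgc : Continuous (gradient φ) :=
    (InnerProductSpace.toDual ℝ (Eu d)).symm.continuous.comp (hφ.continuous_fderiv (by simp))
  have hgs : HasCompactSupport (gradient φ) :=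
    (hc.fderiv (𝕜 := ℝ)).comp_left (g := (InnerProductSpace.toDual ℝ (Eu d)).symm) (map_zero _)
  have h1 := integrable_inner_left
    (hgc.memLp_of_hasCompactSupport (p := 2) (μ := volume.restrict P.dom) hgs) (HDiv.val q)
  have h2 := integrable_inner_left
    (hφ.continuous.memLp_of_hasCompactSupport (p := 2) (μ := volume.restrict P.dom) hc) (HDiv.div q)
  refine (h1.add h2).congr (Filter.Eventually.of_forall fun x => ?_)
  simp

theorem H1.integrableOn_test (u : H1 P) {φ : Eu d → ℝ} (hφ : ContDiff ℝ ∞ φ)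
    (hc : HasCompactSupport φ) (n : Eu d) :
    IntegrableOn (fun x => φ x * ⟪n, H1.grad u x⟫ + fderiv ℝ φ x n * H1.val u x) P.dom := by
  have h1 := integrable_inner_left
    (memLp_smul_const hφ.continuous hc n (volume.restrict P.dom)) (H1.grad u)
  have h2 := integrable_inner_left
    (memLp_fderiv_apply hφ hc n (volume.restrict P.dom)) (H1.val u)
  refine (h1.add h2).congr (Filter.Eventually.of_forall fun x => ?_)
  simp [real_inner_smul_left, mul_comm]

/-- Green's formula near a facet for the restriction of a field. -/
theorem IsRestrHDiv.setIntegral_test {q : HDiv P} {qK : HDiv K} (hq : IsRestrHDiv q qK)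
    (e : K.facets) {φ : Eu d → ℝ} (hφ : ContDiff ℝ ∞ φ) (hc : HasCompactSupport φ)
    (hs : tsupport φ ⊆ K.facetNhd e) :
    ∫ x in K.dom, (⟪HDiv.val q x, gradient φ x⟫ + HDiv.div q x * φ x)
      = ∫ x in (e : Set (Eu d)), φ x * HDiv.ntr qK e x ∂(μHE[d - 1] : Measure (Eu d)) := by
  have := HDiv.green_test qK hφ hc
  rw [Finset.sum_eq_single e] at this
  · rw [← this]
    refine integral_congr_ae ?_
    filter_upwards [hq.1, hq.2] with x h1 h2
    rw [h1, h2]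
  · intro e' _ h
    refine setIntegral_eq_zero_of_disjoint_tsupport (Set.disjoint_left.2 fun x hx hx' => ?_) _
    exact Polytope.notMem_of_facetNhd e'.2 (fun h' => h (Subtype.ext h')) (hs hx') hx
  · simp

/-- Shows that the trace of `uK` is determined by the values and the gradient of `u` near the facet.
-/
theorem IsRestrH1.setIntegral_test {u : H1 P} {uK : H1 K} (hu : IsRestrH1 u uK)
    (e : K.facets) {φ : Eu d → ℝ} (hφ : ContDiff ℝ ∞ φ) (hc : HasCompactSupport φ)
    (hs : tsupport φ ⊆ K.facetNhd e) :
    ∫ x in K.dom, (φ x * ⟪K.normal e, H1.grad u x⟫ + fderiv ℝ φ x (K.normal e) * H1.val u x)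
      = ∫ x in (e : Set (Eu d)), φ x * H1.tr uK e x ∂(μHE[d - 1] : Measure (Eu d)) := by
  rw [← green_facet hφ hc e hs uK]
  refine integral_congr_ae ?_
  filter_upwards [hu.1, hu.2] with x h1 h2
  rw [h1, h2]

theorem integrable_mul_L2Face (e : K.facets) {φ : Eu d → ℝ} (hφ : ContDiff ℝ ∞ φ)
    (hc : HasCompactSupport φ) (f : L2Face (e : Set (Eu d))) :
    Integrable (fun x => φ x * f x) ((μHE[d - 1] : Measure (Eu d)).restrict (e : Set (Eu d))) := by
  refine (integrable_inner_left (hφ.continuous.memLp_of_hasCompactSupport (p := 2) hc) f).congr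
    (Filter.Eventually.of_forall fun x => ?_)
  simp [mul_comm]

/-- The normal traces from the two sides of an interface cancel. -/
theorem ntr_add_ntr_eq_zero (hKP : K.carrier ⊆ P.carrier) (hLP : L.carrier ⊆ P.carrier)
    (hKL : Disjoint K.dom L.dom) (heK : e ∈ K.facets) (heL : e ∈ L.facets)
    (hn : L.normal e = - K.normal e) (ho : L.offset e = - K.offset e)
    (hnull : (μHE[d - 1] : Measure (Eu d)) (e \ (K.facetNhd e ∩ L.facetNhd e)) = 0)
    {q : HDiv P} {qK : HDiv K} {qL : HDiv L} (hqK : IsRestrHDiv q qK) (hqL : IsRestrHDiv q qL) :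
    HDiv.ntr qK ⟨e, heK⟩ + HDiv.ntr qL ⟨e, heL⟩ = 0 := by
  refine L2Face_eq_zero_of_test (e := ⟨e, heK⟩)
    ((K.isOpen_facetNhd e).inter (L.isOpen_facetNhd e)) hnull _ fun φ hφ hc hs => ?_
  have hPdom := hs.trans (Polytope.inter_facetNhd_subset_dom hKP hLP heK heL hn ho)
  have h1 := hqK.setIntegral_test ⟨e, heK⟩ hφ hc (hs.trans inter_subset_left)
  have h2 := hqL.setIntegral_test ⟨e, heL⟩ hφ hc (hs.trans inter_subset_right)
  have h3 := setIntegral_interface hKP hLP hKL heK heL hn ho (HDiv.integrableOn_test q hφ hc)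
    fun x hx => by
      rw [gradient_eq_zero_of_notMem_tsupport fun h => hx (hs h),
        image_eq_zero_of_notMem_tsupport fun h => hx (hs h), inner_zero_right, mul_zero, add_zero]
  -- As `q` has a weak divergence across the interface, no boundary term arises on `P`; the two
  -- element contributions must cancel.
  have h4 : ∫ x in P.dom, (⟪HDiv.val q x, gradient φ x⟫ + HDiv.div q x * φ x) = 0 := by
    rw [HDiv.green_test q hφ hc]
    refine Finset.sum_eq_zero fun e' _ => setIntegral_eq_zero_of_disjoint_tsupport ?_ _
    exact (Polytope.disjoint_facet_dom e'.2).mono_right hPdom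
  rw [h4, h1, h2, ← integral_add (integrable_mul_L2Face ⟨e, heK⟩ hφ hc _)
    (integrable_mul_L2Face ⟨e, heL⟩ hφ hc _)] at h3
  rw [h3]
  refine integral_congr_ae ?_
  filter_upwards [Lp.coeFn_add (HDiv.ntr qK ⟨e, heK⟩) (HDiv.ntr qL ⟨e, heL⟩)] with x hx
  rw [hx, Pi.add_apply, mul_add]

/-- The traces from the two sides of an interface agree. -/
theorem tr_eq_tr (hKP : K.carrier ⊆ P.carrier) (hLP : L.carrier ⊆ P.carrier)
    (hKL : Disjoint K.dom L.dom) (heK : e ∈ K.facets) (heL : e ∈ L.facets)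
    (hn : L.normal e = - K.normal e) (ho : L.offset e = - K.offset e)
    (hnull : (μHE[d - 1] : Measure (Eu d)) (e \ (K.facetNhd e ∩ L.facetNhd e)) = 0)
    {u : H1 P} {uK : H1 K} {uL : H1 L} (huK : IsRestrH1 u uK) (huL : IsRestrH1 u uL) :
    H1.tr uK ⟨e, heK⟩ = H1.tr uL ⟨e, heL⟩ := by
  rw [← sub_eq_zero]
  refine L2Face_eq_zero_of_test (e := ⟨e, heK⟩)
    ((K.isOpen_facetNhd e).inter (L.isOpen_facetNhd e)) hnull _ fun φ hφ hc hs => ?_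
  have hPdom := hs.trans (Polytope.inter_facetNhd_subset_dom hKP hLP heK heL hn ho)
  have h1 := huK.setIntegral_test ⟨e, heK⟩ hφ hc (hs.trans inter_subset_left)
  have h2 := huL.setIntegral_test ⟨e, heL⟩ hφ hc (hs.trans inter_subset_right)
  have h3 := setIntegral_interface hKP hLP hKL heK heL hn ho
    (H1.integrableOn_test u hφ hc (K.normal e))
    fun x hx => by
      rw [image_eq_zero_of_notMem_tsupport fun h => hx (hs h),
        image_eq_zero_of_notMem_tsupport (f := fderiv ℝ φ)
          fun h => hx (hs (tsupport_fderiv_subset ℝ h))]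
      simp
  rw [green_interior hφ hc _ hPdom u, h1] at h3
  -- The same field `φ n_K` is used on both sides; on `L` it is minus the outward one, which turns
  -- the sum into a difference of traces.
  have h4 : ∫ x in L.dom, (φ x * ⟪L.normal e, H1.grad u x⟫ + fderiv ℝ φ x (L.normal e)
      * H1.val u x) = - ∫ x in L.dom, (φ x * ⟪K.normal e, H1.grad u x⟫
        + fderiv ℝ φ x (K.normal e) * H1.val u x) := by
    rw [← integral_neg, hn]
    refine integral_congr_ae (Filter.Eventually.of_forall fun x => ?_)
    simp only [inner_neg_left, map_neg]
    ring
  rw [h4] at h2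
  have h5 : ∫ x in e, φ x * (H1.tr uK ⟨e, heK⟩ - H1.tr uL ⟨e, heL⟩ : L2Face e) x
      ∂(μHE[d - 1] : Measure (Eu d)) = (∫ x in e, φ x * H1.tr uK ⟨e, heK⟩ x
      ∂(μHE[d - 1] : Measure (Eu d))) - ∫ x in e, φ x * H1.tr uL ⟨e, heL⟩ x
      ∂(μHE[d - 1] : Measure (Eu d)) := by
    rw [← integral_sub (integrable_mul_L2Face ⟨e, heK⟩ hφ hc _)
      (integrable_mul_L2Face ⟨e, heL⟩ hφ hc _)]
    refine integral_congr_ae ?_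
    filter_upwards [Lp.coeFn_sub (H1.tr uK ⟨e, heK⟩) (H1.tr uL ⟨e, heL⟩)] with x hx
    rw [hx, Pi.sub_apply, mul_sub]
  refine h5.trans ?_
  rw [← h2]
  linarith

/-- The trace on a boundary facet vanishes for functions with zero boundary values. -/
theorem tr_eq_zero_of_boundary {F : Set (Eu d)} (heK : e ∈ K.facets) (hF : F ∈ P.facets)
    (hn : P.normal F = K.normal e) (ho : P.offset F = K.offset e)
    (hnull : (μHE[d - 1] : Measure (Eu d)) (e \ (K.facetNhd e ∩ P.facetNhd F)) = 0)
    {u : H1 P} {uK : H1 K} (huK : IsRestrH1 u uK) (hu : H1.tr u ⟨F, hF⟩ = 0) :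
    H1.tr uK ⟨e, heK⟩ = 0 := by
  refine L2Face_eq_zero_of_test (e := ⟨e, heK⟩)
    ((K.isOpen_facetNhd e).inter (P.isOpen_facetNhd F)) hnull _ fun φ hφ hc hs => ?_
  have h1 := huK.setIntegral_test ⟨e, heK⟩ hφ hc (hs.trans inter_subset_left)
  have h2 := green_facet hφ hc ⟨F, hF⟩ (hs.trans inter_subset_right) u
  have h3 : ∫ x in F, φ x * H1.tr u ⟨F, hF⟩ x ∂(μHE[d - 1] : Measure (Eu d)) = 0 := by
    rw [hu]
    simpa [mul_comm] using integral_zeroLp_mul ((μHE[d - 1] : Measure (Eu d)).restrict F) φ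
  refine h1.symm.trans (Eq.trans ?_ (h2.trans h3))
  change ∫ x in K.dom, (φ x * ⟪K.normal e, H1.grad u x⟫ + fderiv ℝ φ x (K.normal e) * H1.val u x)
    = ∫ x in P.dom, (φ x * ⟪P.normal F, H1.grad u x⟫ + fderiv ℝ φ x (P.normal F) * H1.val u x)
  rw [hn]
  -- On the support of `φ`, `K` and `P` are the same half-space.
  refine setIntegral_eq_of_inter_eq (U := K.facetNhd e ∩ P.facetNhd F) K.isOpen_dom.measurableSet
    P.isOpen_dom.measurableSet (fun x hx => ?_) fun x hx => ?_
  · rw [Polytope.mem_dom_of_facetNhd heK hx.1, Polytope.mem_dom_of_facetNhd hF hx.2, hn, ho]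
  · rw [image_eq_zero_of_notMem_tsupport fun h => hx (hs h),
        image_eq_zero_of_notMem_tsupport (f := fderiv ℝ φ)
          fun h => hx (hs (tsupport_fderiv_subset ℝ h))]
    simp

end Interface

end Traces

/-! ### How the facets of a mesh meet each other and the boundary. -/

section Mesh

variable {d : ℕ} {T : Type*} {P : Polytope d} {K : T → Polytope d} {e : Set (Eu d)}

theorem IsMesh.carrier_subset (h : IsMesh P K) (t : T) : (K t).carrier ⊆ P.carrier := by
  rw [← h.cover]
  exact subset_iUnion (fun t => (K t).carrier) t

/-- A point of `e` outside `facetNhd e` lies on another facet of the same element, so `conforming`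
applies with both elements equal to `t`. -/
theorem IsMesh.measure_diff_facetNhd (h : IsMesh P K) {t : T} (he : e ∈ (K t).facets) :
    (μHE[d - 1] : Measure (Eu d)) (e \ (K t).facetNhd e) = 0 := by
  refine measure_mono_null (t := ⋃ e' ∈ (K t).facets, ⋃ _ : e ≠ e', e ∩ e') ?_ ?_
  · rintro x ⟨hx, hx'⟩
    by_contra hcon
    refine hx' (Polytope.mem_facetNhd_of_forall_notMem (Polytope.facet_subset he hx)
      fun e' he' hne hxe => hcon ?_)
    exact mem_biUnion he' (mem_iUnion.2 ⟨hne.symm, hx, hxe⟩)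
  · refine (measure_biUnion_null_iff (Finset.countable_toSet _)).2 fun e' he' => ?_
    exact measure_iUnion_null fun hne => h.conforming t t e he e' he' hne

theorem IsMesh.measure_diff_inter (h : IsMesh P K) {s t : T} (hs : e ∈ (K s).facets)
    (ht : e ∈ (K t).facets) :
    (μHE[d - 1] : Measure (Eu d)) (e \ ((K s).facetNhd e ∩ (K t).facetNhd e)) = 0 := by
  rw [sdiff_inter]
  exact measure_union_null (h.measure_diff_facetNhd hs) (h.measure_diff_facetNhd ht)

theorem exists_mem_of_measure_diff {μ : Measure (Eu d)} {U : Set (Eu d)} (he : μ e ≠ 0)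
    (h : μ (e \ U) = 0) : ∃ x ∈ e, x ∈ U := by
  by_contra! hcon
  exact he (measure_mono_null (show e ⊆ e \ U from fun x hx => ⟨hx, hcon x hx⟩) h)

/-- The relation between two elements with a common facet. -/
theorem IsMesh.normal_neg (h : IsMesh P K) {s t : T} (hst : s ≠ t)
    (he : (μHE[d - 1] : Measure (Eu d)) e ≠ 0) (hs : e ∈ (K s).facets) (ht : e ∈ (K t).facets) :
    (K t).normal e = - (K s).normal e ∧ (K t).offset e = - (K s).offset e := by
  obtain ⟨x, hx, hU⟩ := exists_mem_of_measure_diff he (h.measure_diff_inter hs ht)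
  have := Polytope.normal_eq_neg (K := K s) (L := K t) (h.disjoint hst) hs ht hx hx hU.1 hU.2
  exact ⟨this, Polytope.offset_eq_neg hs ht hx hx this⟩

theorem IsMesh.exists_mem_dom (h : IsMesh P K) {s t : T} (hst : s ≠ t)
    (he : (μHE[d - 1] : Measure (Eu d)) e ≠ 0) (hs : e ∈ (K s).facets) (ht : e ∈ (K t).facets) :
    ∃ x ∈ e, x ∈ P.dom := by
  obtain ⟨x, hx, hU⟩ := exists_mem_of_measure_diff he (h.measure_diff_inter hs ht)
  obtain ⟨hn, ho⟩ := h.normal_neg hst he hs ht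
  exact ⟨x, hx, Polytope.inter_facetNhd_subset_dom (h.carrier_subset s) (h.carrier_subset t)
    hs ht hn ho hU⟩

/-- Ensures that functions of `M_h` are unconstrained on a shared facet. -/
theorem IsMesh.not_subset_frontier (h : IsMesh P K) {s t : T} (hst : s ≠ t)
    (he : (μHE[d - 1] : Measure (Eu d)) e ≠ 0) (hs : e ∈ (K s).facets) (ht : e ∈ (K t).facets) :
    ¬ e ⊆ frontier P.dom := by
  intro hsub
  obtain ⟨x, hx, hP⟩ := h.exists_mem_dom hst he hs ht
  have := hsub hx
  rw [P.isOpen_dom.frontier_eq] at this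
  exact this.2 hP

/-- A facet belongs to at most two elements. -/
theorem IsMesh.eq_or_eq (h : IsMesh P K) {s t r : T} (hst : s ≠ t)
    (he : (μHE[d - 1] : Measure (Eu d)) e ≠ 0) (hs : e ∈ (K s).facets) (ht : e ∈ (K t).facets)
    (hr : e ∈ (K r).facets) : r = s ∨ r = t := by
  by_contra! hcon
  -- Three elements would have pairwise opposite unit normals on `e`.
  have h1 := (h.normal_neg hst he hs ht).1
  have h2 := (h.normal_neg hcon.1.symm he hs hr).1
  have h3 := (h.normal_neg hcon.2.symm he ht hr).1
  have := Polytope.inner_normal_self hs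
  rw [h2, h1, neg_neg] at h3
  nth_rewrite 1 [← h3] at this
  rw [inner_neg_left, Polytope.inner_normal_self hs] at this
  norm_num at this

/-- A facet of an element which is not shared with another element lies in the boundary. -/
theorem IsMesh.exists_boundary_facet [Finite T] (h : IsMesh P K) {t : T}
    (he : (μHE[d - 1] : Measure (Eu d)) e ≠ 0) (ht : e ∈ (K t).facets)
    (hex : ∀ s, e ∈ (K s).facets → s = t) :
    ∃ F ∈ P.facets, ∃ x ∈ e, x ∈ (K t).facetNhd e ∧ x ∈ F := by
  by_contra! hcon
  refine he ?_
  have hsub : e ⊆ (e \ (K t).facetNhd e) ∪ ⋃ s, ⋃ e' ∈ (K s).facets, ⋃ _ : e ≠ e', e ∩ e' := by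
    intro x hx
    by_cases hxU : x ∈ (K t).facetNhd e
    swap
    · exact Or.inl ⟨hx, hxU⟩
    refine Or.inr ?_
    have hxP : x ∈ P.dom := by
      by_contra hxP
      obtain ⟨F, hF, hxF⟩ := Polytope.exists_facet_of_mem_carrier
        (h.carrier_subset t (Polytope.facet_subset ht hx)) hxP
      exact hcon F hF x hx hxU hxF
    have hnn := Polytope.inner_normal_self ht
    have hcl : IsClosed (⋃ s ∈ {s | s ≠ t}, (K s).carrier) :=
      (Set.toFinite _).isClosed_biUnion fun s _ => (K s).isClosed_carrier
    have hc : Filter.Tendsto (fun ε : ℝ => x + ε • (K t).normal e) (nhdsWithin 0 (Ioi 0))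
        (nhds x) := by
      have : Continuous fun ε : ℝ => x + ε • (K t).normal e := by fun_prop
      simpa using (this.tendsto 0).mono_left nhdsWithin_le_nhds
    -- Just beyond `e` the points lie in `P` but not in `K t`, hence in other elements; their finite
    -- union is closed and so contains `x`.
    have hmem : x ∈ ⋃ s ∈ {s | s ≠ t}, (K s).carrier := by
      refine hcl.mem_of_tendsto hc ?_
      filter_upwards [Polytope.eventually_add_smul_mem P.isOpen_dom hxP ((K t).normal e),
        self_mem_nhdsWithin] with ε h1 h2
      have h3 := P.dom_subset h1
      rw [← h.cover] at h3
      obtain ⟨s, hs⟩ := mem_iUnion.1 h3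
      refine mem_biUnion (x := s) ?_ hs
      rintro rfl
      have h4 := Polytope.mem_carrier.1 hs e ht
      rw [inner_add_right, inner_smul_right, hnn, ((Polytope.mem_facet ht).1 hx).2] at h4
      have : (0 : ℝ) < ε := h2
      linarith
    obtain ⟨s, hst, hxs⟩ := mem_iUnion₂.1 hmem
    -- Otherwise the interiors of `K s` and `K t` would meet near `x`. Hence `x` lies on a facet of
    -- `K s`, different from `e` by `hex`, and such points form a null set.
    have hxs' : x ∉ (K s).dom := by
      intro hxs'
      have k1 : ⟪(K t).normal e, -(K t).normal e⟫ < 0 := by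
        rw [inner_neg_right, hnn]; norm_num
      obtain ⟨ε, h1, h2⟩ := ((Polytope.eventually_mem_dom ht hx hxU k1).and
        (Polytope.eventually_add_smul_mem (K s).isOpen_dom hxs' (-(K t).normal e))).exists
      exact (h.disjoint hst).notMem_of_mem_left h2 h1
    obtain ⟨e', he', hxe'⟩ := Polytope.exists_facet_of_mem_carrier hxs hxs'
    refine mem_iUnion.2 ⟨s, mem_biUnion he' (mem_iUnion.2 ⟨?_, hx, hxe'⟩)⟩
    rintro rfl
    exact hst (hex s he')
  refine measure_mono_null hsub (measure_union_null (h.measure_diff_facetNhd ht) ?_)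
  refine measure_iUnion_null fun s => ?_
  refine (measure_biUnion_null_iff (Finset.countable_toSet _)).2 fun e' he' => ?_
  exact measure_iUnion_null fun hne => h.conforming t s e ht e' he' hne

/-- Any facet of `P` through a relative interior point of `e` has the normal and offset of `e`,
hence those of `F`, and so is `F`. -/
theorem IsMesh.measure_diff_boundary (h : IsMesh P K) {t : T} (ht : e ∈ (K t).facets)
    {F : Set (Eu d)} (hF : F ∈ P.facets) (hn : P.normal F = (K t).normal e)
    (ho : P.offset F = (K t).offset e) :
    (μHE[d - 1] : Measure (Eu d)) (e \ ((K t).facetNhd e ∩ P.facetNhd F)) = 0 := by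
  refine measure_mono_null ?_ (h.measure_diff_facetNhd ht)
  rintro x ⟨hx, hx'⟩
  refine ⟨hx, fun hU => hx' ⟨hU, ?_⟩⟩
  refine Polytope.mem_facetNhd_of_forall_notMem
    (h.carrier_subset t (Polytope.facet_subset ht hx)) fun F' hF' hne hxF' => hne ?_
  have hn' := Polytope.normal_eq_of_subset (h.carrier_subset t) ht hF' hx hxF' hU
  have ho' := Polytope.offset_eq_of_normal_eq ht hF' hx hxF' hn'
  rw [P.facet_eq F' hF', P.facet_eq F hF, hn, hn', ho, ho']

/-- The trace of a function with zero boundary values vanishes on a facet which is not shared. -/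
theorem IsMesh.tr_eq_zero [Finite T] (h : IsMesh P K) {t : T}
    (he : (μHE[d - 1] : Measure (Eu d)) e ≠ 0) (ht : e ∈ (K t).facets)
    (hex : ∀ s, e ∈ (K s).facets → s = t) {u : H1 P} (hu : ∀ F : P.facets, H1.tr u F = 0)
    {uK : H1 (K t)} (huK : IsRestrH1 u uK) : H1.tr uK ⟨e, ht⟩ = 0 := by
  obtain ⟨F, hF, x, hx, hU, hxF⟩ := h.exists_boundary_facet he ht hex
  have hn := Polytope.normal_eq_of_subset (h.carrier_subset t) ht hF hx hxF hU
  have ho := Polytope.offset_eq_of_normal_eq ht hF hx hxF hn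
  exact tr_eq_zero_of_boundary ht hF hn ho (h.measure_diff_boundary ht hF hn ho) huK (hu _)

/-- Disposes of null facets, so that the geometric lemmas may assume positive measure. -/
theorem L2Face_eq_zero_of_measure_eq_zero (he : (μHE[d - 1] : Measure (Eu d)) e = 0)
    (f : L2Face e) : f = 0 := by
  rw [Lp.eq_zero_iff_ae_eq_zero, Filter.EventuallyEq, ae_iff]
  exact measure_mono_null (subset_univ _) (by rwa [Measure.restrict_apply_univ])

end Mesh

/-! ### Regrouping sums over element boundaries by facets. -/

section FacetSums

variable {d : ℕ} {T : Type*} [Fintype T] {K : T → Polytope d}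

open scoped Classical in
/-- The sum of the values of `A` on the facet `e` over all elements with this facet. -/
noncomputable def facetSum (A : ∀ t, (K t).facets → ℝ) (e : Set (Eu d)) : ℝ :=
  ∑ t, if h : e ∈ (K t).facets then A t ⟨e, h⟩ else 0

open scoped Classical in
theorem sum_eq_sum_facetSum (A : ∀ t, (K t).facets → ℝ) :
    ∑ t, ∑ e, A t e = ∑ e ∈ Finset.univ.biUnion fun t => (K t).facets, facetSum A e := by
  simp only [facetSum]
  rw [Finset.sum_comm]
  refine Finset.sum_congr rfl fun t _ => ?_
  rw [← Finset.sum_subset (s₁ := (K t).facets)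
    (Finset.subset_biUnion_of_mem (fun t => (K t).facets) (Finset.mem_univ t))
    (fun e _ he => dif_neg he),
    ← Finset.sum_coe_sort (K t).facets fun e => if h : e ∈ (K t).facets then A t ⟨e, h⟩ else 0]
  exact Finset.sum_congr rfl fun e _ => by rw [dif_pos e.2]

theorem sum_eq_zero_of_facetSum (A : ∀ t, (K t).facets → ℝ) (h : ∀ e, facetSum A e = 0) :
    ∑ t, ∑ e, A t e = 0 := by
  rw [sum_eq_sum_facetSum]
  exact Finset.sum_eq_zero fun e _ => h e

theorem sum_eq_facetSum (A : ∀ t, (K t).facets → ℝ) (e : Set (Eu d))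
    (h : ∀ t, ∀ e' : (K t).facets, (e' : Set (Eu d)) ≠ e → A t e' = 0) :
    ∑ t, ∑ e', A t e' = facetSum A e := by
  classical
  rw [sum_eq_sum_facetSum, Finset.sum_eq_single e]
  · intro e' _ hne
    refine Finset.sum_eq_zero fun t _ => ?_
    split_ifs with ht
    · exact h t ⟨e', ht⟩ hne
    · rfl
  · intro he
    refine Finset.sum_eq_zero fun t _ => dif_neg fun ht => he ?_
    exact Finset.mem_biUnion.2 ⟨t, Finset.mem_univ t, ht⟩

theorem facetSum_eq_single (A : ∀ t, (K t).facets → ℝ) {e : Set (Eu d)} {t : T}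
    (ht : e ∈ (K t).facets) (hex : ∀ s, e ∈ (K s).facets → s = t) :
    facetSum A e = A t ⟨e, ht⟩ := by
  rw [facetSum, Finset.sum_eq_single t, dif_pos ht]
  · exact fun s _ hs => dif_neg fun h => hs (hex s h)
  · simp

theorem facetSum_eq_add (A : ∀ t, (K t).facets → ℝ) {e : Set (Eu d)} {s t : T} (hst : s ≠ t)
    (hs : e ∈ (K s).facets) (ht : e ∈ (K t).facets)
    (hex : ∀ r, e ∈ (K r).facets → r = s ∨ r = t) :
    facetSum A e = A s ⟨e, hs⟩ + A t ⟨e, ht⟩ := by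
  classical
  rw [facetSum, ← Finset.sum_subset (Finset.subset_univ {s, t}), Finset.sum_pair hst, dif_pos hs,
    dif_pos ht]
  intro r _ hr
  simp only [Finset.mem_insert, Finset.mem_singleton] at hr
  exact dif_neg fun h => hr (hex r h)

end FacetSums

/-! ### Linear algebra of the `M`-decomposition. -/

section MDecomposition

/-- The elements of `A` whose image under `L` is orthogonal to the image of `B`. -/
noncomputable def orthWithin {E F : Type*} [AddCommGroup E] [Module ℝ E] [NormedAddCommGroup F]
    [InnerProductSpace ℝ F] (L : E →ₗ[ℝ] F) (A B : Submodule ℝ E) : Submodule ℝ E :=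
  A ⊓ ((B.map L)ᗮ).comap L

theorem mem_orthWithin {E F : Type*} [AddCommGroup E] [Module ℝ E] [NormedAddCommGroup F]
    [InnerProductSpace ℝ F] {L : E →ₗ[ℝ] F} {A B : Submodule ℝ E} {x : E} :
    x ∈ orthWithin L A B ↔ x ∈ A ∧ ∀ y ∈ B, inner ℝ (L x) (L y) = (0 : ℝ) := by
  simp only [orthWithin, Submodule.mem_inf, Submodule.mem_comap, Submodule.mem_orthogonal,
    Submodule.mem_map, forall_exists_index, and_imp, forall_apply_eq_imp_iff₂]
  simp only [real_inner_comm]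

/-- The least squares approximation. -/
theorem exists_mem_inner_eq {E F : Type*} [AddCommGroup E] [Module ℝ E] [NormedAddCommGroup F]
    [InnerProductSpace ℝ F] (L : E →ₗ[ℝ] F) (B : Submodule ℝ E) [FiniteDimensional ℝ B] (x : F) :
    ∃ y ∈ B, ∀ z ∈ B, (inner ℝ (L y) (L z) : ℝ) = inner ℝ x (L z) := by
  obtain ⟨y, hy, hyx⟩ := Submodule.mem_map.1 ((B.map L).starProjection_apply_mem x)
  refine ⟨y, hy, fun z hz => ?_⟩
  rw [hyx, Submodule.inner_starProjection_left_eq_right,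
    Submodule.starProjection_eq_self_iff.2 (Submodule.mem_map_of_mem hz)]

/-- An injective linear map between spaces which are related by a bijective linear map is
surjective. -/
theorem exists_eq_of_injOn {E F : Type*} [AddCommGroup E] [Module ℝ E] [AddCommGroup F] [Module ℝ F]
    (A : Submodule ℝ E) (B : Submodule ℝ F) [FiniteDimensional ℝ A] (f g : E →ₗ[ℝ] F)
    (hf : ∀ y ∈ B, ∃! x, x ∈ A ∧ f x = y) (hfm : ∀ x ∈ A, f x ∈ B) (hgm : ∀ x ∈ A, g x ∈ B)
    (hg : ∀ x ∈ A, g x = 0 → x = 0) {y : F} (hy : y ∈ B) : ∃ x ∈ A, g x = y := by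
  have hbij : Function.Bijective (f.restrict hfm) := by
    constructor
    · intro a b hab
      have h := congrArg Subtype.val hab
      exact Subtype.ext ((hf (f b) (hfm b b.2)).unique ⟨a.2, h⟩ ⟨b.2, rfl⟩)
    · intro z
      obtain ⟨x, hx, _⟩ := hf z z.2
      exact ⟨⟨x, hx.1⟩, Subtype.ext hx.2⟩
  let φ : A ≃ₗ[ℝ] B := LinearEquiv.ofBijective _ hbij
  have : FiniteDimensional ℝ B := Module.Finite.equiv φ
  have hinj : Function.Injective (g.restrict hgm) := by
    rw [← LinearMap.ker_eq_bot, LinearMap.ker_eq_bot']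
    intro a ha
    exact Subtype.ext (hg a a.2 (congrArg Subtype.val ha))
  obtain ⟨x, hx⟩ := (LinearMap.injective_iff_surjective_of_finrank_eq_finrank φ.finrank_eq).1 hinj
    ⟨y, hy⟩
  exact ⟨x, x.2, congrArg Subtype.val hx⟩

/-- The data of an `M`-decomposition, with the fields `X`, the functions `Y`, and their values,
divergences, gradients and traces in inner product spaces: the equations for the HDG-projection
are solvable. -/
theorem exists_projection_of_decomposition {X Y E F ι : Type*} [AddCommGroup X] [Module ℝ X]
    [AddCommGroup Y] [Module ℝ Y] [NormedAddCommGroup E] [InnerProductSpace ℝ E]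
    [NormedAddCommGroup F] [InnerProductSpace ℝ F] [Fintype ι] {G : ι → Type*}
    [∀ i, NormedAddCommGroup (G i)] [∀ i, InnerProductSpace ℝ (G i)]
    (vX : X →ₗ[ℝ] E) (dX : X →ₗ[ℝ] F) (nX : ∀ i, X →ₗ[ℝ] G i)
    (vY : Y →ₗ[ℝ] F) (gY : Y →ₗ[ℝ] E) (tY : ∀ i, Y →ₗ[ℝ] G i)
    (green : ∀ x y, (inner ℝ (vX x) (gY y) : ℝ) + inner ℝ (dX x) (vY y)
      = ∑ i, inner ℝ (nX i x) (tY i y))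
    (V V' : Submodule ℝ X) (W W' : Submodule ℝ Y) (M : ∀ i, Submodule ℝ (G i))
    [FiniteDimensional ℝ V] [FiniteDimensional ℝ W] (hV : ∀ v ∈ V, ∀ i, nX i v ∈ M i)
    (hW : ∀ w ∈ W, ∀ i, tY i w ∈ M i) (hV' : V' ≤ V) (hW' : W' ≤ W)
    (hgrad : ∀ w ∈ W, ∃ v ∈ V', vX v = gY w) (hdiv : ∀ v ∈ V, ∃ w ∈ W', vY w = dX v)
    (hiso : ∀ μ : ∀ i, G i, (∀ i, μ i ∈ M i) → ∃! p : X × Y,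
      (p.1 ∈ V ∧ ∀ v ∈ V', inner ℝ (vX p.1) (vX v) = (0 : ℝ)) ∧
      (p.2 ∈ W ∧ ∀ w ∈ W', inner ℝ (vY p.2) (vY w) = (0 : ℝ)) ∧
      ∀ i, nX i p.1 + tY i p.2 = μ i)
    {τ : ι → ℝ} (hτ : ∀ i, 0 < τ i) (a : E) (b : F) (c : ∀ i, G i) (hc : ∀ i, c i ∈ M i) :
    ∃ x ∈ V, ∃ y ∈ W, (∀ v ∈ V, (inner ℝ (vY y) (dX v) : ℝ) = inner ℝ b (dX v)) ∧
      (∀ w ∈ W, (inner ℝ (vX x) (gY w) : ℝ) = inner ℝ a (gY w)) ∧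
      ∀ i, nX i x + τ i • tY i y = c i := by
  have : FiniteDimensional ℝ V' := Submodule.finiteDimensional_of_le hV'
  have : FiniteDimensional ℝ W' := Submodule.finiteDimensional_of_le hW'
  -- Gradients of `W` lie in `V'` and divergences of `V` in `W'`, so `p` and `w` satisfy both volume
  -- equations, and adding anything orthogonal preserves them.
  obtain ⟨p, hp, hpa⟩ := exists_mem_inner_eq vX V' a
  obtain ⟨w, hw, hwb⟩ := exists_mem_inner_eq vY W' b
  -- The weight `σ = 1` is the trace map of the `M`-decomposition, `σ = τ` that of the projection.
  let tm : (ι → ℝ) → (X × Y) →ₗ[ℝ] ∀ i, G i := fun σ =>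
    LinearMap.pi fun i => (nX i).comp (LinearMap.fst ℝ X Y)
      + σ i • (tY i).comp (LinearMap.snd ℝ X Y)
  have htm : ∀ σ p i, tm σ p i = nX i p.1 + σ i • tY i p.2 := fun σ p i => rfl
  have : FiniteDimensional ℝ (orthWithin vX V V') :=
    Submodule.finiteDimensional_of_le (S₂ := V) inf_le_left
  have : FiniteDimensional ℝ (orthWithin vY W W') :=
    Submodule.finiteDimensional_of_le (S₂ := W) inf_le_left
  let A := (orthWithin vX V V').prod (orthWithin vY W W')
  have : FiniteDimensional ℝ A :=
    Module.Finite.iff_fg.2 ((Module.Finite.iff_fg.1 inferInstance).prod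
      (Module.Finite.iff_fg.1 inferInstance))
  let B : Submodule ℝ (∀ i, G i) := Submodule.pi univ M
  have memB : ∀ μ, μ ∈ B ↔ ∀ i, μ i ∈ M i := fun μ => by simp [B, Submodule.mem_pi]
  have memA : ∀ x, x ∈ A ↔ (x.1 ∈ V ∧ ∀ v ∈ V', inner ℝ (vX x.1) (vX v) = (0 : ℝ)) ∧
      (x.2 ∈ W ∧ ∀ w ∈ W', inner ℝ (vY x.2) (vY w) = (0 : ℝ)) := fun x => by
    rw [Submodule.mem_prod, mem_orthWithin, mem_orthWithin]
  have hmem : ∀ σ : ι → ℝ, ∀ x ∈ A, tm σ x ∈ B := by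
    intro σ x hx
    obtain ⟨h1, h2⟩ := (memA x).1 hx
    exact (memB _).2 fun i => (M i).add_mem (hV _ h1.1 i) ((M i).smul_mem _ (hW _ h2.1 i))
  have hbij : ∀ y ∈ B, ∃! x, x ∈ A ∧ tm (fun _ => 1) x = y := by
    intro y hy
    obtain ⟨x, hx, hx'⟩ := hiso y ((memB y).1 hy)
    refine ⟨x, ⟨(memA x).2 ⟨hx.1, hx.2.1⟩, funext fun i => ?_⟩, ?_⟩
    · rw [htm, one_smul]; exact hx.2.2 i
    · rintro z ⟨hz, hz'⟩
      obtain ⟨h1, h2⟩ := (memA z).1 hz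
      refine hx' z ⟨h1, h2, fun i => ?_⟩
      rw [← hz', htm, one_smul]
  -- Orthogonality removes both volume terms of Green's formula; with `v·n = -τw` its boundary term
  -- is `-∑ τ‖w‖²`. Hence both traces vanish, and uniqueness for `σ = 1` gives `x = 0`.
  have hinj : ∀ x ∈ A, tm τ x = 0 → x = 0 := by
    intro x hx h0
    obtain ⟨h1, h2⟩ := (memA x).1 hx
    have hntr : ∀ i, nX i x.1 = - (τ i • tY i x.2) := fun i =>
      eq_neg_of_add_eq_zero_left (congrFun h0 i)
    obtain ⟨v, hv, hvw⟩ := hgrad x.2 h2.1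
    obtain ⟨z, hz, hzv⟩ := hdiv x.1 h1.1
    have e1 : (inner ℝ (vX x.1) (gY x.2) : ℝ) = 0 := by
      rw [← hvw]; exact h1.2 v hv
    have e2 : (inner ℝ (dX x.1) (vY x.2) : ℝ) = 0 := by
      rw [← hzv, real_inner_comm]; exact h2.2 z hz
    have hsum : ∑ i, τ i * ‖tY i x.2‖ ^ 2 = 0 := by
      have hg := green x.1 x.2
      rw [e1, e2, add_zero] at hg
      rw [← neg_eq_zero, ← Finset.sum_neg_distrib]
      refine Eq.trans (Finset.sum_congr rfl fun i _ => ?_) hg.symm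
      rw [hntr, inner_neg_left, real_inner_smul_left, real_inner_self_eq_norm_sq]
    have htr : ∀ i, tY i x.2 = 0 := by
      intro i
      have := (Finset.sum_eq_zero_iff_of_nonneg
        (fun i _ => mul_nonneg (hτ i).le (sq_nonneg _))).1 hsum i (Finset.mem_univ i)
      exact norm_eq_zero.1 (pow_eq_zero_iff two_ne_zero |>.1
        ((mul_eq_zero.1 this).resolve_left (hτ i).ne'))
    refine (hbij 0 B.zero_mem).unique ⟨hx, funext fun i => ?_⟩ ⟨A.zero_mem, map_zero _⟩
    rw [htm, hntr, htr]
    simp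
  -- The boundary data left for the orthogonal part once `(p, w)` is fixed.
  have hy : (fun i => c i - tm τ (p, w) i) ∈ B := (memB _).2 fun i =>
    (M i).sub_mem (hc i) ((M i).add_mem (hV _ (hV' hp) i) ((M i).smul_mem _ (hW _ (hW' hw) i)))
  obtain ⟨x, hx, hxy⟩ := exists_eq_of_injOn A B (tm fun _ => 1) (tm τ) hbij
    (hmem _) (hmem _) hinj hy
  obtain ⟨h1, h2⟩ := (memA x).1 hx
  refine ⟨p + x.1, V.add_mem (hV' hp) h1.1, w + x.2, W.add_mem (hW' hw) h2.1, fun v hv => ?_,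
    fun z hz => ?_, fun i => ?_⟩
  · obtain ⟨w', hw', h⟩ := hdiv v hv
    rw [← h, map_add, inner_add_left, hwb w' hw', h2.2 w' hw', add_zero]
  · obtain ⟨v', hv', h⟩ := hgrad z hz
    rw [← h, map_add, inner_add_left, hpa v' hv', h1.2 v' hv', add_zero]
  · have hxi := congrFun hxy i
    rw [htm] at hxi
    rw [map_add, map_add, smul_add, add_add_add_comm, hxi, htm]
    abel

end MDecomposition

/-! ### Existence of the HDG-projection. -/

section Projection

variable {d : ℕ} {K : Polytope d} {M : ∀ e : Set (Eu d), Submodule ℝ (L2Face e)}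

theorem HDiv.val_sub (v w : HDiv K) : HDiv.val (v - w) = HDiv.val v - HDiv.val w := rfl
theorem H1.val_sub (v w : H1 K) : H1.val (v - w) = H1.val v - H1.val w := rfl

/-- The vector field as a linear map. -/
noncomputable def HDiv.valL (K : Polytope d) : HDiv K →ₗ[ℝ] L2Vec K where
  toFun := HDiv.val
  map_add' _ _ := rfl
  map_smul' _ _ := rfl

/-- The divergence as a linear map. -/
noncomputable def HDiv.divL (K : Polytope d) : HDiv K →ₗ[ℝ] L2 K where
  toFun := HDiv.div
  map_add' _ _ := rfl
  map_smul' _ _ := rfl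

/-- The normal trace as a linear map. -/
noncomputable def HDiv.ntrL (K : Polytope d) (e : K.facets) :
    HDiv K →ₗ[ℝ] L2Face (e : Set (Eu d)) where
  toFun v := HDiv.ntr v e
  map_add' _ _ := rfl
  map_smul' _ _ := rfl

/-- The function as a linear map. -/
noncomputable def H1.valL (K : Polytope d) : H1 K →ₗ[ℝ] L2 K where
  toFun := H1.val
  map_add' _ _ := rfl
  map_smul' _ _ := rfl

/-- The gradient as a linear map. -/
noncomputable def H1.gradL (K : Polytope d) : H1 K →ₗ[ℝ] L2Vec K where
  toFun := H1.grad
  map_add' _ _ := rfl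
  map_smul' _ _ := rfl

/-- The trace as a linear map. -/
noncomputable def H1.trL (K : Polytope d) (e : K.facets) :
    H1 K →ₗ[ℝ] L2Face (e : Set (Eu d)) where
  toFun v := H1.tr v e
  map_add' _ _ := rfl
  map_smul' _ _ := rfl

theorem inner_starProjection_of_mem {F : Type*} [NormedAddCommGroup F] [InnerProductSpace ℝ F]
    (S : Submodule ℝ F) [FiniteDimensional ℝ S] (x : F) {y : F} (hy : y ∈ S) :
    (inner ℝ (S.starProjection x) y : ℝ) = inner ℝ x y := by
  rw [Submodule.inner_starProjection_left_eq_right, Submodule.starProjection_eq_self_iff.2 hy]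

/-- Against `M(e)`, `q·n` and its projection are indistinguishable; this turns the weak boundary
equation into an identity in `M(e)`. -/
theorem inner_starProjection_add_smul {F : Type*} [NormedAddCommGroup F] [InnerProductSpace ℝ F]
    (S : Submodule ℝ F) [FiniteDimensional ℝ S] (x z : F) (c : ℝ) {y : F} (hy : y ∈ S) :
    (inner ℝ (S.starProjection x + c • S.starProjection z) y : ℝ)
      = inner ℝ (x + c • S.starProjection z) y := by
  rw [inner_add_left, inner_add_left, inner_starProjection_of_mem S x hy]

/-- Existence of the HDG-projection. -/
theorem exists_isHDGProjection (V : Submodule ℝ (HDiv K)) (W : Submodule ℝ (H1 K))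
    [FiniteDimensional ℝ V] [FiniteDimensional ℝ W] [∀ e, FiniteDimensional ℝ (M e)]
    (hV : ∀ v ∈ V, ∀ e : K.facets, HDiv.ntr v e ∈ M e)
    (hW : ∀ w ∈ W, ∀ e : K.facets, H1.tr w e ∈ M e)
    (hdec : AdmitsMDecomposition K V W M) {τ : K.facets → ℝ} (hτ : ∀ e, 0 < τ e)
    (q : HDiv K) (u : H1 K) :
    ∃ (PVq : HDiv K) (PWu : H1 K), IsHDGProjection K V W M τ q u PVq PWu := by
  obtain ⟨-, V', W', hV', hW', hgrad, hdiv, hiso⟩ := hdec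
  obtain ⟨x, hx, y, hy, h1, h2, h3⟩ := exists_projection_of_decomposition
    (HDiv.valL K) (HDiv.divL K) (HDiv.ntrL K) (H1.valL K) (H1.gradL K) (H1.trL K)
    HDiv.green V V' W W' (fun e : K.facets => M e) hV hW hV' hW' hgrad hdiv hiso hτ
    (HDiv.val q) (H1.val u)
    (fun e => (M (e : Set (Eu d))).starProjection (HDiv.ntr q e)
      + τ e • (M (e : Set (Eu d))).starProjection (H1.tr u e))
    (fun e => (M (e : Set (Eu d))).add_mem (Submodule.starProjection_apply_mem _ _)
      ((M (e : Set (Eu d))).smul_mem _ (Submodule.starProjection_apply_mem _ _)))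
  refine ⟨x, y, hx, hy, h1, h2, fun μ hμ => Finset.sum_congr rfl fun e _ => ?_⟩
  rw [← inner_starProjection_add_smul _ _ _ _ (hμ e), ← h3 e]
  rfl

end Projection

/-! ### Normal components on facets. -/

section Faces

variable {d : ℕ} {e : Set (Eu d)}

theorem coeFn_dotN (n : Eu d) (r : L2FaceVec e) :
    dotN n r =ᵐ[(μHE[d - 1] : Measure (Eu d)).restrict e] fun x => ⟪n, r x⟫ :=
  (innerSL ℝ n).coeFn_compLp r

theorem coeFn_mulN (n : Eu d) (μ : L2Face e) :
    mulN n μ =ᵐ[(μHE[d - 1] : Measure (Eu d)).restrict e] fun x => μ x • n :=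
  (ContinuousLinearMap.toSpanSingleton ℝ n).coeFn_compLp μ

theorem dotN_mulN {n : Eu d} (hn : ‖n‖ = 1) (μ : L2Face e) : dotN n (mulN n μ) = μ := by
  refine Lp.ext ?_
  filter_upwards [coeFn_dotN n (mulN n μ), coeFn_mulN n μ] with x h1 h2
  rw [h1, h2, real_inner_smul_right, real_inner_self_eq_norm_sq, hn]
  simp

theorem dotN_neg (n : Eu d) (r : L2FaceVec e) : dotN (-n) r = - dotN n r := by
  refine Lp.ext ?_
  filter_upwards [coeFn_dotN n r, coeFn_dotN (-n) r, Lp.coeFn_neg (dotN n r)] with x h1 h2 h3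
  rw [h2, h3, Pi.neg_apply, h1, inner_neg_left]

theorem dotN_zero (n : Eu d) : dotN n (0 : L2FaceVec e) = 0 := by
  refine Lp.ext ?_
  filter_upwards [coeFn_dotN n (0 : L2FaceVec e),
    Lp.coeFn_zero (Eu d) 2 ((μHE[d - 1] : Measure (Eu d)).restrict e),
    Lp.coeFn_zero ℝ 2 ((μHE[d - 1] : Measure (Eu d)).restrict e)] with x h1 h2 h3
  rw [h1, h2, h3]
  simp

end Faces

/-! ### Transmission conditions facet by facet. -/

section FaceJumps

variable {d : ℕ} {T : Type*} [Fintype T] {P : Polytope d} {K : T → Polytope d}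
  {V : ∀ t, Submodule ℝ (HDiv (K t))} {W : ∀ t, Submodule ℝ (H1 (K t))}
  {M : ∀ e : Set (Eu d), Submodule ℝ (L2Face e)} {N : ∀ e : Set (Eu d), Submodule ℝ (L2FaceVec e)}
  {τ : ∀ t, (K t).facets → ℝ} {f : L2 P} {qh : ∀ t, HDiv (K t)} {uh : ∀ t, H1 (K t)}
  {qhat : ∀ t, ∀ e : (K t).facets, L2FaceVec (e : Set (Eu d))} {uhat : ∀ t, L2Bdry (K t)}

-- Extending `r` by zero to all other facets gives a function of `N_h`, so the transmission
-- condition localizes.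
open scoped Classical in
theorem IsHDGSolution.facetSum_uhat (h : IsHDGSolution P K V W M N τ f qh uh qhat uhat)
    (e : Set (Eu d)) {r : L2FaceVec e} (hr : r ∈ N e) :
    facetSum (fun t (e' : (K t).facets) => (inner ℝ (uhat t e') (dotN ((K t).normal e')
      (Function.update (fun e' : Set (Eu d) => (0 : L2FaceVec e')) e r e')) : ℝ)) e = 0 := by
  rw [← sum_eq_facetSum _ e fun t e' hne => by
    rw [Function.update_of_ne hne, dotN_zero, inner_zero_right]]
  refine h.trans_uhat _ fun e' => ?_
  rcases eq_or_ne e' e with rfl | hne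
  · rwa [Function.update_self]
  · rw [Function.update_of_ne hne]; exact (N e').zero_mem

-- Here the extension by zero must also vanish on boundary facets, whence the restriction on `e`.
open scoped Classical in
theorem IsHDGSolution.facetSum_qhat (h : IsHDGSolution P K V W M N τ f qh uh qhat uhat)
    {e : Set (Eu d)} (he : ¬ e ⊆ frontier P.dom) {μ : L2Face e} (hμ : μ ∈ M e) :
    facetSum (fun t (e' : (K t).facets) => (inner ℝ (dotN ((K t).normal e') (qhat t e'))
      (Function.update (fun e' : Set (Eu d) => (0 : L2Face e')) e μ e') : ℝ)) e = 0 := by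
  rw [← sum_eq_facetSum _ e fun t e' hne => by
    rw [Function.update_of_ne hne, inner_zero_right]]
  refine h.trans_qhat _ (fun e' => ?_) fun t e' _ hsub => ?_
  · rcases eq_or_ne e' e with rfl | hne
    · rwa [Function.update_self]
    · rw [Function.update_of_ne hne]; exact (M e').zero_mem
  · rw [Function.update_of_ne]
    rintro rfl
    exact he hsub

/-- On a facet which is not shared, the hybrid variable `uhat` vanishes. -/
theorem IsHDGSolution.uhat_eq_zero (h : IsHDGSolution P K V W M N τ f qh uh qhat uhat)
    (hFE : IsFESpaces K V W M N) {e : Set (Eu d)} {t : T} (ht : e ∈ (K t).facets)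
    (hex : ∀ s, e ∈ (K s).facets → s = t) : uhat t ⟨e, ht⟩ = 0 := by
  -- The test field `r = û n` is admissible even on the boundary, as `N_h` carries no boundary
  -- condition.
  have h1 := h.facetSum_uhat e (hFE.A1 t e ht _ (h.uhat_mem t ⟨e, ht⟩))
  rw [facetSum_eq_single _ ht hex, Function.update_self,
    dotN_mulN ((K t).norm_normal e ht)] at h1
  exact inner_self_eq_zero.1 h1

/-- On a facet with two elements, the hybrid variable `uhat` is single-valued. -/
theorem IsHDGSolution.uhat_eq_uhat (h : IsHDGSolution P K V W M N τ f qh uh qhat uhat)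
    (hFE : IsFESpaces K V W M N) {e : Set (Eu d)} {s t : T} (hst : s ≠ t)
    (hs : e ∈ (K s).facets) (ht : e ∈ (K t).facets)
    (hex : ∀ r, e ∈ (K r).facets → r = s ∨ r = t) (hn : (K t).normal e = - (K s).normal e) :
    uhat s ⟨e, hs⟩ = uhat t ⟨e, ht⟩ := by
  have hmem : uhat s ⟨e, hs⟩ - uhat t ⟨e, ht⟩ ∈ M e :=
    (M e).sub_mem (h.uhat_mem s ⟨e, hs⟩) (h.uhat_mem t ⟨e, ht⟩)
  -- With `r` the jump times `n_s` and `n_t = -n_s`, the two contributions add up to the squared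
  -- norm of the jump.
  have h1 := h.facetSum_uhat e (hFE.A1 s e hs _ hmem)
  rw [facetSum_eq_add _ hst hs ht hex, Function.update_self] at h1
  simp only [hn] at h1
  rw [dotN_neg, dotN_mulN ((K s).norm_normal e hs), inner_neg_right, ← sub_eq_add_neg,
    ← inner_sub_left] at h1
  exact sub_eq_zero.1 (inner_self_eq_zero.1 h1)

/-- On a facet with two elements, the normal components of the hybrid variable `qhat` cancel. -/
theorem IsHDGSolution.dotN_add_dotN (h : IsHDGSolution P K V W M N τ f qh uh qhat uhat)
    (hFE : IsFESpaces K V W M N) {e : Set (Eu d)} {s t : T} (hst : s ≠ t)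
    (hs : e ∈ (K s).facets) (ht : e ∈ (K t).facets)
    (hex : ∀ r, e ∈ (K r).facets → r = s ∨ r = t) (he : ¬ e ⊆ frontier P.dom) :
    dotN ((K s).normal e) (qhat s ⟨e, hs⟩) + dotN ((K t).normal e) (qhat t ⟨e, ht⟩) = 0 := by
  have hmem : dotN ((K s).normal e) (qhat s ⟨e, hs⟩) + dotN ((K t).normal e) (qhat t ⟨e, ht⟩)
      ∈ M e :=
    (M e).add_mem (hFE.A2 s e hs _ (h.qhat_mem s ⟨e, hs⟩)) (hFE.A2 t e ht _ (h.qhat_mem t ⟨e, ht⟩))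
  have h1 := h.facetSum_qhat he hmem
  rw [facetSum_eq_add _ hst hs ht hex, Function.update_self] at h1
  rw [← inner_add_left] at h1
  exact inner_self_eq_zero.1 h1

/-- The hybrid error and the normal flux error are orthogonal on the skeleton of the mesh. -/
theorem IsHDGSolution.sum_inner_hybrid_eq_zero
    (h : IsHDGSolution P K V W M N τ f qh uh qhat uhat) (hFE : IsFESpaces K V W M N)
    (hmesh : IsMesh P K) [∀ e, FiniteDimensional ℝ (M e)] {q : HDiv P} {u : H1 P}
    (hu : ∀ F : P.facets, H1.tr u F = 0)
    {qK : ∀ t, HDiv (K t)} (hqK : ∀ t, IsRestrHDiv q (qK t))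
    {uK : ∀ t, H1 (K t)} (huK : ∀ t, IsRestrH1 u (uK t)) :
    ∑ t, ∑ e : (K t).facets,
      (inner ℝ ((M (e : Set (Eu d))).starProjection (H1.tr (uK t) e) - uhat t e)
        ((M (e : Set (Eu d))).starProjection (HDiv.ntr (qK t) e)
          - dotN ((K t).normal e) (qhat t e)) : ℝ) = 0 := by
  classical
  refine sum_eq_zero_of_facetSum _ fun e => ?_
  by_cases hμ : (μHE[d - 1] : Measure (Eu d)) e = 0
  · refine Finset.sum_eq_zero fun t _ => ?_
    split_ifs with ht
    · exact (congrArg (fun x => (inner ℝ x _ : ℝ))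
        (L2Face_eq_zero_of_measure_eq_zero hμ _)).trans (inner_zero_left _)
    · rfl
  by_cases hne : ∃ t, e ∈ (K t).facets
  swap
  · push Not at hne
    exact Finset.sum_eq_zero fun t _ => dif_neg (hne t)
  obtain ⟨t, ht⟩ := hne
  -- On an unshared facet the first factor is zero; on a shared one it agrees from both sides and
  -- the second factors cancel.
  by_cases hex : ∀ s, e ∈ (K s).facets → s = t
  · rw [facetSum_eq_single _ ht hex, h.uhat_eq_zero hFE ht hex,
      hmesh.tr_eq_zero hμ ht hex hu (huK t), map_zero, sub_zero, inner_zero_left]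
  · push Not at hex
    obtain ⟨s, hs, hst⟩ := hex
    have hex : ∀ r, e ∈ (K r).facets → r = s ∨ r = t := fun r hr => hmesh.eq_or_eq hst hμ hs ht hr
    obtain ⟨hn, ho⟩ := hmesh.normal_neg hst hμ hs ht
    have hq := ntr_add_ntr_eq_zero (hmesh.carrier_subset s) (hmesh.carrier_subset t)
      (hmesh.disjoint hst) hs ht hn ho (hmesh.measure_diff_inter hs ht) (hqK s) (hqK t)
    have hu := tr_eq_tr (hmesh.carrier_subset s) (hmesh.carrier_subset t)
      (hmesh.disjoint hst) hs ht hn ho (hmesh.measure_diff_inter hs ht) (huK s) (huK t)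
    have hb := h.dotN_add_dotN hFE hst hs ht hex (hmesh.not_subset_frontier hst hμ hs ht)
    rw [facetSum_eq_add _ hst hs ht hex, hu, h.uhat_eq_uhat hFE hst hs ht hex hn, ← inner_add_right,
      eq_neg_of_add_eq_zero_left hq, eq_neg_of_add_eq_zero_left hb, map_neg]
    simp

end FaceJumps

/-! ### The energy identity. -/

section Energy

/-- Prefixes `n` and `t` mark normal traces and traces, suffixes `h` and `P` the discrete solution
and the projection; `nq`, `tu` are exact traces and `b` is `q̂·n`. The two hypotheses express
`e_q·n` through `e_u - e_û`, and tests in `S` allow `nq`, `tu` to be projected. -/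
theorem facet_energy {F : Type*} [NormedAddCommGroup F] [InnerProductSpace ℝ F]
    (S : Submodule ℝ F) [FiniteDimensional ℝ S] {nq nh nP tu th tP b û : F} {c : ℝ}
    (hflux : nh - b + c • (th - û) = 0)
    (hproj : nP + c • tP = S.starProjection nq + c • S.starProjection tu)
    (hn : nP - nh ∈ S) (ht : tP - th ∈ S) :
    (inner ℝ tu (nP - nh) : ℝ) - inner ℝ û (nP - nh) + inner ℝ nq (tP - th) - inner ℝ b (tP - th)
        - inner ℝ (nP - nh) (tP - th)
      = c * ‖tP - th - (S.starProjection tu - û)‖ ^ 2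
        + inner ℝ (S.starProjection tu - û) (S.starProjection nq - b) := by
  have hE : nP - nh = S.starProjection nq - b - c • (tP - th - (S.starProjection tu - û)) := by
    rw [eq_sub_of_add_eq hproj, sub_eq_iff_eq_add.1 (eq_neg_of_add_eq_zero_left hflux)]
    simp only [smul_sub]
    abel
  rw [← inner_starProjection_of_mem S tu hn, ← inner_starProjection_of_mem S nq ht,
    ← inner_sub_left, add_sub_assoc, ← inner_sub_left, hE, ← real_inner_self_eq_norm_sq]
  generalize S.starProjection tu - û = ê
  generalize S.starProjection nq - b = g
  generalize tP - th = t
  simp only [inner_sub_left, inner_sub_right, real_inner_smul_left, real_inner_smul_right]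
  rw [real_inner_comm t ê]
  ring

variable {d : ℕ} {K : Polytope d} {V : Submodule ℝ (HDiv K)} {W : Submodule ℝ (H1 K)}
  {M : ∀ e : Set (Eu d), Submodule ℝ (L2Face e)} [∀ e, FiniteDimensional ℝ (M e)]
  {τ : K.facets → ℝ} {q PVq : HDiv K} {u PWu : H1 K}

/-- The difference of the two sides lies in `M(∂K)`, hence may serve as its own test function. -/
theorem IsHDGProjection.trace_eq (h : IsHDGProjection K V W M τ q u PVq PWu)
    (hV : ∀ v ∈ V, ∀ e : K.facets, HDiv.ntr v e ∈ M e)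
    (hW : ∀ w ∈ W, ∀ e : K.facets, H1.tr w e ∈ M e) (e : K.facets) :
    HDiv.ntr PVq e + τ e • H1.tr PWu e
      = (M (e : Set (Eu d))).starProjection (HDiv.ntr q e)
        + τ e • (M (e : Set (Eu d))).starProjection (H1.tr u e) := by
  let D : L2Bdry K := fun e => HDiv.ntr PVq e + τ e • H1.tr PWu e
      - ((M (e : Set (Eu d))).starProjection (HDiv.ntr q e)
        + τ e • (M (e : Set (Eu d))).starProjection (H1.tr u e))
  have hD : ∀ e : K.facets, D e ∈ M e := fun e =>
    (M (e : Set (Eu d))).sub_mem ((M (e : Set (Eu d))).add_mem (hV _ h.memV e)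
      ((M (e : Set (Eu d))).smul_mem _ (hW _ h.memW e)))
      ((M (e : Set (Eu d))).add_mem (Submodule.starProjection_apply_mem _ _)
        ((M (e : Set (Eu d))).smul_mem _ (Submodule.starProjection_apply_mem _ _)))
  have h1 : ∑ e, (inner ℝ (D e) (D e) : ℝ) = 0 := by
    have h2 := h.eq_bdry D hD
    rw [← sub_eq_zero, ← Finset.sum_sub_distrib] at h2
    rw [← h2]
    refine Finset.sum_congr rfl fun e _ => ?_
    rw [← inner_starProjection_add_smul _ _ _ _ (hD e), ← inner_sub_left]
  have h3 := (Finset.sum_eq_zero_iff_of_nonneg fun e _ => real_inner_self_nonneg).1 h1 e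
    (Finset.mem_univ e)
  exact sub_eq_zero.1 (inner_self_eq_zero.1 h3)

set_option maxHeartbeats 1000000 in
/-- The energy identity on an element. -/
theorem element_energy (h : IsHDGProjection K V W M τ q u PVq PWu)
    (hV : ∀ v ∈ V, ∀ e : K.facets, HDiv.ntr v e ∈ M e)
    (hW : ∀ w ∈ W, ∀ e : K.facets, H1.tr w e ∈ M e)
    (hqu : HDiv.val q + H1.grad u = 0) {qh : HDiv K} {uh : H1 K} (hqh : qh ∈ V) (huh : uh ∈ W)
    {b û : L2Bdry K} (hflux : ∀ e, HDiv.ntr qh e - b e + τ e • (H1.tr uh e - û e) = 0) :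
    ‖HDiv.val (PVq - qh)‖ ^ 2
      + ∑ e : K.facets, (τ e * ‖H1.tr (PWu - uh) e
        - ((M (e : Set (Eu d))).starProjection (H1.tr u e) - û e)‖ ^ 2
        + inner ℝ ((M (e : Set (Eu d))).starProjection (H1.tr u e) - û e)
          ((M (e : Set (Eu d))).starProjection (HDiv.ntr q e) - b e))
      + inner ℝ (HDiv.val q - HDiv.val PVq) (HDiv.val (PVq - qh))
      + ((inner ℝ (HDiv.val qh) (HDiv.val (PVq - qh)) : ℝ)
        - inner ℝ (H1.val uh) (HDiv.div (PVq - qh))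
        + ∑ e : K.facets, inner ℝ (û e) (HDiv.ntr (PVq - qh) e))
      + (-(inner ℝ (HDiv.val qh) (H1.grad (PWu - uh)) : ℝ)
        + ∑ e : K.facets, inner ℝ (b e) (H1.tr (PWu - uh) e)
        - inner ℝ (HDiv.div q) (H1.val (PWu - uh))) = 0 := by
  have hv : PVq - qh ∈ V := V.sub_mem h.memV hqh
  have hw : PWu - uh ∈ W := W.sub_mem h.memW huh
  have hfac : ∀ e : K.facets, τ e * ‖H1.tr (PWu - uh) e
        - ((M (e : Set (Eu d))).starProjection (H1.tr u e) - û e)‖ ^ 2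
        + inner ℝ ((M (e : Set (Eu d))).starProjection (H1.tr u e) - û e)
          ((M (e : Set (Eu d))).starProjection (HDiv.ntr q e) - b e)
      = (inner ℝ (H1.tr u e) (HDiv.ntr (PVq - qh) e) : ℝ)
        - inner ℝ (û e) (HDiv.ntr (PVq - qh) e) + inner ℝ (HDiv.ntr q e) (H1.tr (PWu - uh) e)
        - inner ℝ (b e) (H1.tr (PWu - uh) e)
        - inner ℝ (HDiv.ntr (PVq - qh) e) (H1.tr (PWu - uh) e) := fun e =>
    (facet_energy (M (e : Set (Eu d))) (hflux e) (h.trace_eq hV hW e) (hV _ hv e) (hW _ hw e)).symm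
  rw [Finset.sum_congr rfl fun e _ => hfac e]
  simp only [Finset.sum_add_distrib, Finset.sum_sub_distrib]
  -- The last two brackets of the claim are the residuals of the HDG equations with `∇·q` for `f`.
  -- The claim is a linear combination of three Green identities and the two volume equations of the
  -- projection.
  have g1 := HDiv.green (PVq - qh) u
  have g2 := HDiv.green q (PWu - uh)
  have g3 := HDiv.green (PVq - qh) (PWu - uh)
  have p1 := h.eq_div _ hv
  have p2 := h.eq_grad _ hw
  rw [eq_neg_of_add_eq_zero_right hqu, inner_neg_right] at g1
  have c1 : ∑ e : K.facets, (inner ℝ (H1.tr u e) (HDiv.ntr (PVq - qh) e) : ℝ)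
      = ∑ e : K.facets, (inner ℝ (HDiv.ntr (PVq - qh) e) (H1.tr u e) : ℝ) :=
    Finset.sum_congr rfl fun e _ => real_inner_comm _ _
  have c2 : (inner ℝ (HDiv.val (PVq - qh)) (HDiv.val q) : ℝ)
      = inner ℝ (HDiv.val q) (HDiv.val (PVq - qh)) := real_inner_comm _ _
  have c3 : (inner ℝ (HDiv.div (PVq - qh)) (H1.val u) : ℝ)
      = inner ℝ (H1.val u) (HDiv.div (PVq - qh)) := real_inner_comm _ _
  have n1 : ‖HDiv.val (PVq - qh)‖ ^ 2 = (inner ℝ (HDiv.val PVq) (HDiv.val (PVq - qh)) : ℝ)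
      - inner ℝ (HDiv.val qh) (HDiv.val (PVq - qh)) := by
    rw [← real_inner_self_eq_norm_sq, ← inner_sub_left, ← HDiv.val_sub]
  have n2 : (inner ℝ (HDiv.val (PVq - qh)) (H1.grad (PWu - uh)) : ℝ)
      = inner ℝ (HDiv.val PVq) (H1.grad (PWu - uh)) - inner ℝ (HDiv.val qh) (H1.grad (PWu - uh)) := by
    rw [← inner_sub_left, ← HDiv.val_sub]
  have n3 : (inner ℝ (HDiv.div (PVq - qh)) (H1.val (PWu - uh)) : ℝ)
      = inner ℝ (H1.val PWu) (HDiv.div (PVq - qh)) - inner ℝ (H1.val uh) (HDiv.div (PVq - qh)) := by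
    rw [real_inner_comm, H1.val_sub, inner_sub_left]
  have n4 : (inner ℝ (HDiv.val q - HDiv.val PVq) (HDiv.val (PVq - qh)) : ℝ)
      = inner ℝ (HDiv.val q) (HDiv.val (PVq - qh))
        - inner ℝ (HDiv.val PVq) (HDiv.val (PVq - qh)) := inner_sub_left _ _ _
  linarith

theorem norm_sqrt_smul_sq {F : Type*} [NormedAddCommGroup F] [NormedSpace ℝ F] {c : ℝ}
    (hc : 0 ≤ c) (x : F) : ‖Real.sqrt c • x‖ ^ 2 = c * ‖x‖ ^ 2 := by
  rw [norm_smul, mul_pow, Real.norm_eq_abs, sq_abs, Real.sq_sqrt hc]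

theorem neg_two_mul_inner_le {F : Type*} [NormedAddCommGroup F] [InnerProductSpace ℝ F] (x y : F) :
    -2 * (inner ℝ x y : ℝ) ≤ ‖x‖ ^ 2 + ‖y‖ ^ 2 := by
  have := norm_add_sq_real x y
  nlinarith [sq_nonneg ‖x + y‖]

theorem IsExactSolution.restr {P : Polytope d} {f : L2 P} {q : HDiv P} {u : H1 P}
    (h : IsExactSolution P f q u) (hKP : K.carrier ⊆ P.carrier) {qK : HDiv K}
    (hq : IsRestrHDiv q qK) {uK : H1 K} (hu : IsRestrH1 u uK) :
    HDiv.val qK + H1.grad uK = 0 := by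
  have hP : ∀ᵐ x ∂(volume : Measure (Eu d)).restrict P.dom,
      HDiv.val q x + H1.grad u x = 0 := by
    have h1 := h.flux
    rw [Lp.eq_zero_iff_ae_eq_zero] at h1
    filter_upwards [h1, Lp.coeFn_add (HDiv.val q) (H1.grad u)] with x hx hx'
    rw [hx', Pi.add_apply] at hx
    exact hx
  rw [Lp.eq_zero_iff_ae_eq_zero]
  filter_upwards [ae_mono (Measure.restrict_mono_set _ (Polytope.dom_mono hKP)) hP, hq.1, hu.2,
    Lp.coeFn_add (HDiv.val qK) (H1.grad uK)] with x h1 h2 h3 h4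
  rw [h4, Pi.add_apply, h2, h3, h1]
  rfl

theorem IsExactSolution.setIntegral_mul {P : Polytope d} {f : L2 P} {q : HDiv P} {u : H1 P}
    (h : IsExactSolution P f q u) {qK : HDiv K} (hq : IsRestrHDiv q qK) (w : H1 K) :
    ∫ x in K.dom, f x * H1.val w x = inner ℝ (HDiv.div qK) (H1.val w) := by
  rw [L2.inner_def, ← h.balance]
  refine integral_congr_ae ?_
  filter_upwards [hq.2] with x hx
  rw [hx]
  simp [mul_comm]

end Energy

end HDG

open HDG in
theorem mainTheorem3 {d : ℕ} (hd : d = 2 ∨ d = 3) {T : Type*} [Fintype T]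
    (P : Polytope d) (K : T → Polytope d) (hmesh : IsMesh P K)
    (V : ∀ t, Submodule ℝ (HDiv (K t))) (W : ∀ t, Submodule ℝ (H1 (K t)))
    (M : ∀ e : Set (Eu d), Submodule ℝ (L2Face e))
    (N : ∀ e : Set (Eu d), Submodule ℝ (L2FaceVec e))
    [∀ t, FiniteDimensional ℝ (V t)] [∀ t, FiniteDimensional ℝ (W t)]
    [∀ e, FiniteDimensional ℝ (M e)] [∀ e, FiniteDimensional ℝ (N e)]
    (hFE : IsFESpaces K V W M N)
    (hMdec : ∀ t, AdmitsMDecomposition (K t) (V t) (W t) M)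
    (τ : ∀ t, (K t).facets → ℝ) (hτ : ∀ t e, 0 < τ t e)
    (f : L2 P) (q : HDiv P) (u : H1 P) (hexact : IsExactSolution P f q u)
    (qK : ∀ t, HDiv (K t)) (hqK : ∀ t, IsRestrHDiv q (qK t))
    (uK : ∀ t, H1 (K t)) (huK : ∀ t, IsRestrH1 u (uK t)) :
    (∃ (PVq : ∀ t, HDiv (K t)) (PWu : ∀ t, H1 (K t)),
      ∀ t, IsHDGProjection (K t) (V t) (W t) M (τ t) (qK t) (uK t) (PVq t) (PWu t)) ∧
    ∀ (qh : ∀ t, HDiv (K t)) (uh : ∀ t, H1 (K t))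
      (qhat : ∀ t, ∀ e : (K t).facets, L2FaceVec (e : Set (Eu d)))
      (uhat : ∀ t, L2Bdry (K t)),
      IsHDGSolution P K V W M N τ f qh uh qhat uhat →
      ∀ (PVq : ∀ t, HDiv (K t)) (PWu : ∀ t, H1 (K t)),
      (∀ t, IsHDGProjection (K t) (V t) (W t) M (τ t) (qK t) (uK t) (PVq t) (PWu t)) →
      ∑ t, ‖HDiv.val (PVq t - qh t)‖ ^ 2
        + 2 * ∑ t, ∑ e : (K t).facets,
            ‖Real.sqrt (τ t e) • (H1.tr (PWu t - uh t) e
              - ((M (e : Set (Eu d))).starProjection (H1.tr (uK t) e) - uhat t e))‖ ^ 2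
      ≤ ∑ t, ‖HDiv.val (qK t) - HDiv.val (PVq t)‖ ^ 2 := by
  constructor
  · choose PVq PWu h using fun t => exists_isHDGProjection (V t) (W t) (hFE.A3 t) (hFE.A4 t)
      (hMdec t) (hτ t) (qK t) (uK t)
    exact ⟨PVq, PWu, h⟩
  intro qh uh qhat uhat hsol PVq PWu hproj
  have hzero := hsol.sum_inner_hybrid_eq_zero hFE hmesh hexact.dirichlet hqK huK
  have hgrad := hsol.grad_eq (fun t => PVq t - qh t)
    fun t => (V t).sub_mem (hproj t).memV (hsol.qh_mem t)
  have hdiv := hsol.div_eq (fun t => PWu t - uh t)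
    fun t => (W t).sub_mem (hproj t).memW (hsol.uh_mem t)
  rw [Finset.sum_congr rfl fun t _ => hexact.setIntegral_mul (hqK t) (PWu t - uh t),
    ← sub_eq_zero, ← Finset.sum_neg_distrib] at hdiv
  have hen := fun t => element_energy (b := fun e => dotN ((K t).normal e) (qhat t e))
    (û := uhat t) (hproj t) (hFE.A3 t) (hFE.A4 t)
    (hexact.restr (hmesh.carrier_subset t) (hqK t) (huK t)) (hsol.qh_mem t) (hsol.uh_mem t)
    (hsol.flux t)
  have hsum := Finset.sum_eq_zero (s := Finset.univ) fun t _ => hen t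
  simp only [Finset.sum_add_distrib, Finset.sum_sub_distrib] at hsum
  -- Twice the energy identity has `2‖e_q‖²` on the left; Young's inequality gives back one
  -- `‖e_q‖²`, leaving the factors one and two of the estimate.
  have hyoung : ∀ t, -2 * (inner ℝ (HDiv.val (qK t) - HDiv.val (PVq t))
      (HDiv.val (PVq t - qh t)) : ℝ)
      ≤ ‖HDiv.val (qK t) - HDiv.val (PVq t)‖ ^ 2 + ‖HDiv.val (PVq t - qh t)‖ ^ 2 :=
    fun t => neg_two_mul_inner_le _ _
  have hyoung' := Finset.sum_le_sum (s := Finset.univ) fun t _ => hyoung t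
  rw [← Finset.mul_sum, Finset.sum_add_distrib] at hyoung'
  have hsqrt : ∑ t, ∑ e : (K t).facets, ‖Real.sqrt (τ t e) • (H1.tr (PWu t - uh t) e
      - ((M (e : Set (Eu d))).starProjection (H1.tr (uK t) e) - uhat t e))‖ ^ 2
      = ∑ t, ∑ e : (K t).facets, τ t e * ‖H1.tr (PWu t - uh t) e
      - ((M (e : Set (Eu d))).starProjection (H1.tr (uK t) e) - uhat t e)‖ ^ 2 :=
    Finset.sum_congr rfl fun t _ => Finset.sum_congr rfl fun e _ =>
      norm_sqrt_smul_sq (hτ t e).le _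
  rw [hsqrt]
  linarith
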